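/- Let $\mathcal V$ be a finite vocabulary and consider the infinite token tree whose nodes are the words $w$ over $\mathcal V$, rooted at the currently known prefix (the empty word $r$). The next-token distributions $\beta(\cdot\mid w)$ of the target model at the nodes $w$ are i.i.d. random probability vectors on $\mathcal V$, and the probability that such a vector is a point mass is less than $1$. For a node $w=x_1\cdots x_n$ let $$P(w)=\prod_{i=1}^{n}\beta(x_i\mid x_1\cdots x_{i-1}),\qquad V(w)=-\log P(w)\in[0,\infty],$$ and let $N(t)=\#\{w: V(w)\le t\}$. Write $\beta_x=\beta(x\mid r)$ and $$\mu=\mathbb E\Big[-\sum_{x\in\mathcal V}\beta_x\log\beta_x\Big],\qquad \mu_{(2)}=\mathbb E\Big[\sum_{x\in\mathcal V}\beta_x\log^2\beta_x\Big]$$ (so that $0<\mu<\infty$ and $\mu_{(2)}<\infty$). Assume that the point process $\Xi_{\log}=\{-\log\beta_x : x\in\mathcal V,\ \beta_x>0\}$ is non-arithmetic, i.e. there are no constants $\lambda>0$ and $c_0\in\mathbb R$ such that almost surely $\Xi_{\log}\subseteq c_0+\lambda\mathbb Z$. In one iteration with parallel token capacity $P$, a deterministic drafting algorithm, which may use full knowledge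 of the token tree, chooses a draft tree: a subtree of the token tree that contains $r$ and has at most $P$ nodes. The target model generates a random token sequence which, given all the distributions $\beta$, starts with the word $w$ with probability $P(w)$; a node of the draft tree is accepted if it is an initial segment of this sequence. Let $X$ be the number of nodes, including $r$, on the longest accepted path of the draft tree, i.e. the number of tokens obtained in the iteration (the accepted draft tokens plus the one token added by the verifier). Then, for all integers $P\ge 1+\mu_{(2)}/\mu^2$ and every such drafting algorithm, $$\mathbb E[X]\le\frac{\log P}{\mu}+o(\log P)\qquad (P\to\infty),$$ where the error term does not depend on the drafting algorithm. Moreover, $\mathbb E[N(t)]<\infty$ for every $t$, and $$\mathbb E[N(t)]=\frac{e^t}{\mu}+o(e^t)\qquad (t\to\infty).$$ -/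

import Mathlib

open MeasureTheory ProbabilityTheory Filter Asymptotics
open scoped ENNReal

noncomputable section

namespace SpecDec

/-- The token tree over the vocabulary `V`: a node is the word of tokens read from the root (the
prefix known at the start of the iteration, here `[]`), the children of `w` are `w ++ [x]`, and
`e w x` is the weight of the edge from `w` to `w ++ [x]`, that is, the probability that the target
model continues `w` with the token `x`. -/
abbrev Env (V : Type*) := List V → V → ℝ

/-- `P(w)`: the product of the weights of the edges on the path from the root to `w`. -/
def pathProb {V : Type*} (e : Env V) (w : List V) : ℝ :=
  ∏ i : Fin w.length, e (w.take i) (w.get i)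

/-- `V(w) = - log P(w)`, the position of `w` in the branching random walk; it is `⊤` if
`P(w) = 0`. -/
def position {V : Type*} (e : Env V) (w : List V) : EReal :=
  -ENNReal.log (ENNReal.ofReal (pathProb e w))

/-- `N(t)`: the number of nodes whose position is at most `t`. -/
def nodeCount {V : Type*} (e : Env V) (t : ℝ) : ℝ≥0∞ :=
  ((Set.encard {w : List V | position e w ≤ (t : EReal)} : ℕ∞) : ℝ≥0∞)

/-- The next-token distributions `β w` at the prefixes `w` are i.i.d. random probability vectors
on `V`, and the probability that such a vector is a point mass is less than `1`. -/
structure IsIIDModel {V Ω : Type*} [Fintype V] [MeasurableSpace Ω]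
    (β : List V → Ω → V → ℝ) (Pr : Measure Ω) : Prop where
  measurable : ∀ w, Measurable (β w)
  mem_simplex : ∀ w ω, β w ω ∈ stdSimplex ℝ V
  indep : iIndepFun β Pr
  ident : ∀ w, IdentDistrib (β w) (β []) Pr Pr
  not_pointMass : Pr {ω | ∃ x, β [] ω x = 1} < 1

/-- The realisation of the token tree. -/
def env {V Ω : Type*} (β : List V → Ω → V → ℝ) (ω : Ω) : Env V := fun w => β w ω

/-- `w` is an initial segment of the sequence `y`. -/
def IsInitial {V : Type*} (y : ℕ → V) (w : List V) : Prop :=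
  ∀ i : Fin w.length, y i = w.get i

/-- `Y 0, Y 1, …` is the sequence of tokens that the target model generates after the known
prefix: given all the next-token distributions, it starts with the word `w` with probability
`P(w)`. -/
structure IsGenerated {V Ω : Type*} [MeasurableSpace Ω]
    (β : List V → Ω → V → ℝ) (Y : ℕ → Ω → V) (Pr : Measure Ω) : Prop where
  measurable : ∀ n x, MeasurableSet {ω | Y n ω = x}
  condProb : ∀ w : List V,
    Pr⟦{ω | IsInitial (fun n => Y n ω) w} |
        MeasurableSpace.comap (env β) (inferInstance : MeasurableSpace (Env V))⟧
      =ᵐ[Pr] fun ω => pathProb (env β ω) w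

/-- A deterministic drafting algorithm with capacity `P`: a (measurable) function that returns a
draft tree, a subtree of the token tree that contains the root and has at most `P` nodes. The
algorithm may use full knowledge of the token tree, but not the outcome of the verification. -/
structure Drafter (V : Type*) (P : ℕ) where
  tree : Env V → Finset (List V)
  root_mem : ∀ e, [] ∈ tree e
  parent_mem : ∀ e w x, w ++ [x] ∈ tree e → w ∈ tree e
  card_le : ∀ e, (tree e).card ≤ P
  measurable : ∀ w, MeasurableSet {e | w ∈ tree e}

open Classical in
/-- The number of nodes, with the root counted, on the longest accepted path of the draft tree
`T`, when the target model generates the sequence `y`: a node is accepted when it is an initial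
segment of `y`. This is the number of new tokens of the iteration, since the verifier adds one
token to the accepted draft tokens. -/
def acceptedLength {V : Type*} (T : Finset (List V)) (y : ℕ → V) : ℕ :=
  (T.filter fun w => IsInitial y w).sup fun w => w.length + 1

/-- `X`: the number of tokens obtained in an iteration with the drafter `D`. -/
def numTokens {V Ω : Type*} {P : ℕ} (β : List V → Ω → V → ℝ) (Y : ℕ → Ω → V)
    (D : Drafter V P) (ω : Ω) : ℕ :=
  acceptedLength (D.tree (env β ω)) fun n => Y n ω

/-- `μ`: the expected entropy of the next-token distribution. -/
def meanEntropy {V Ω : Type*} [Fintype V] [MeasurableSpace Ω]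
    (β : List V → Ω → V → ℝ) (Pr : Measure Ω) : ℝ :=
  ∫ ω, -∑ x, β [] ω x * Real.log (β [] ω x) ∂Pr

/-- `μ₍₂₎`: the expected second log-moment of the next-token distribution. -/
def meanSqLog {V Ω : Type*} [Fintype V] [MeasurableSpace Ω]
    (β : List V → Ω → V → ℝ) (Pr : Measure Ω) : ℝ :=
  ∫ ω, ∑ x, β [] ω x * Real.log (β [] ω x) ^ 2 ∂Pr

/-- The points `- log β_x` of the point process `Ξ_log`; tokens of probability `0` give no
point. -/
def logPoints {V Ω : Type*} (β : List V → Ω → V → ℝ) (ω : Ω) : Set ℝ :=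
  {y | ∃ x, 0 < β [] ω x ∧ y = -Real.log (β [] ω x)}

/-- A point process is arithmetic if, for some `δ > 0` and `c`, almost surely all its points lie in
the grid `c + δ ℤ`. -/
def IsArithmetic {Ω : Type*} [MeasurableSpace Ω] (Ξ : Ω → Set ℝ) (Pr : Measure Ω) : Prop :=
  ∃ δ > (0 : ℝ), ∃ c : ℝ, ∀ᵐ ω ∂Pr, ∀ y ∈ Ξ ω, ∃ k : ℤ, y = c + δ * k

end SpecDec

end

/-! Let `Z t = exp (-t) * E[N(t)]` (`renewalFn`). If a token is drawn from the next-token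
distribution, the step `-log β_x` has a law `ν` (`stepMeasure`) on `[0, ∞)` with mean `μ`. Splitting
a word at its last letter gives the many-to-one formula `levelFn_succ`: each generation's share of
`Z` is the convolution of the previous one with `ν`. Summed over generations, `Z - Z * ν` is the
exponential density (`renewalFn_sub_integral`), and the renewal theorem
`tendsto_of_renewal_equation` yields `Z → 1 / μ`, which is the asymptotics of `E[N(t)]`. Finiteness
comes from the a priori bound `le_of_sub_integral_le_expKernel`, uniform over partial sums of
generations.

The renewal theorem rests on a Choquet–Deny type argument. A bounded Lipschitz function that
asymptotically equals its `ν`-average, and approaches its upper limit along some sequence, also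
approaches it after shifts by elements of the semigroup generated by the support of `ν`. For
non-arithmetic `ν` this forces it to stay near that limit on long intervals. Applied to differences
of increments of `∫ Z`, whose sums telescope, this shows that the increments vary slowly;
integrating the renewal equation once more identifies their limit.

For drafting, `X` is at most the number of accepted nodes, so `E[X]` is at most the expected sum of
`P(w)` over the draft tree. Since `P(w) ≤ exp (-t) + ∫_0^t exp (-s) 1{V(w) ≤ s} ds`, a tree of at
most `P` nodes gives `E[X] ≤ P * exp (-t) + ∫_0^t Z`. With `t = log P` this is `1 + ∫_0^{log P} Z =
log P / μ + o(log P)`, whatever the algorithm (`integral_numTokens_le`). -/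

noncomputable section

namespace SpecDec

open Topology NNReal

/-! ### Bounded functions that asymptotically equal their `ν`-average -/

section Renewal

variable {ν : Measure ℝ} [IsProbabilityMeasure ν]

lemma integrable_comp_sub {f : ℝ → ℝ} (hf : Measurable f) {B : ℝ} (hB : ∀ t, |f t| ≤ B) (t : ℝ) :
    Integrable (fun s => f (t - s)) ν :=
  Integrable.of_bound (hf.comp (measurable_const.sub measurable_id)).aestronglyMeasurable B
    (Eventually.of_forall fun s => by simpa using hB (t - s))

/-- A bounded function that nearly equals its `ν`-average in the limit and approaches its upper
limit `η` along `u` approaches it in the mean around `u`. -/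
lemma tendsto_integral_abs_sub {f : ℝ → ℝ} (hf : Measurable f) {B : ℝ} (hB : ∀ t, |f t| ≤ B)
    (hd : Tendsto (fun t => f t - ∫ s, f (t - s) ∂ν) atTop (𝓝 0)) {η : ℝ}
    (hη : ∀ ε > 0, ∀ᶠ t in atTop, f t < η + ε) {u : ℕ → ℝ} (hu : Tendsto u atTop atTop)
    (hfu : Tendsto (fun n => f (u n)) atTop (𝓝 η)) :
    Tendsto (fun n => ∫ s, |f (u n - s) - η| ∂ν) atTop (𝓝 0) := by
  have hm : ∀ n, Measurable fun s => f (u n - s) := fun n =>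
    hf.comp (measurable_const.sub measurable_id)
  -- For fixed `s` the points `u n - s` tend to infinity, so any excess over the upper limit `η`
  -- vanishes pointwise.
  have hp : Tendsto (fun n => ∫ s, max (f (u n - s) - η) 0 ∂ν) atTop (𝓝 (∫ _, (0 : ℝ) ∂ν)) := by
    refine tendsto_integral_of_dominated_convergence (fun _ => B + |η|) (fun n => ?_)
      (integrable_const _) (fun n => Eventually.of_forall fun s => ?_)
      (Eventually.of_forall fun s => ?_)
    · exact (((hm n).sub_const η).max measurable_const).aestronglyMeasurable
    · rw [Real.norm_eq_abs, abs_of_nonneg (le_max_right _ _)]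
      refine max_le ?_ (add_nonneg ((abs_nonneg _).trans (hB 0)) (abs_nonneg _))
      linarith [le_abs_self (f (u n - s)), hB (u n - s), neg_abs_le η]
    · rw [Metric.tendsto_atTop']
      intro ε hε
      have h1 : Tendsto (fun n => u n - s) atTop atTop := tendsto_atTop_add_const_right _ _ hu
      obtain ⟨N, hN⟩ := eventually_atTop.1 (h1.eventually (hη ε hε))
      refine ⟨N, fun n hn => ?_⟩
      have h2 := hN n hn.le
      rw [Real.dist_eq, sub_zero, abs_of_nonneg (le_max_right _ _)]
      exact max_lt (by linarith) hε
  have hq : Tendsto (fun n => f (u n) - ∫ s, f (u n - s) ∂ν) atTop (𝓝 0) := hd.comp hu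
  -- By `|y| = 2 * max y 0 - y` only the positive part needs control: the mean of `f (u n - s) - η`
  -- already tends to `0`.
  have key : ∀ n, ∫ s, |f (u n - s) - η| ∂ν
      = 2 * ∫ s, max (f (u n - s) - η) 0 ∂ν + ((f (u n) - ∫ s, f (u n - s) ∂ν) - f (u n) + η) := by
    intro n
    have i1 := integrable_comp_sub (ν := ν) hf hB (u n)
    have i2 : Integrable (fun s => f (u n - s) - η) ν := i1.sub (integrable_const _)
    have i3 : Integrable (fun s => max (f (u n - s) - η) 0) ν := i2.pos_part
    have e : ∀ s, |f (u n - s) - η| = 2 * max (f (u n - s) - η) 0 - (f (u n - s) - η) := by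
      intro s
      rcases le_total (f (u n - s) - η) 0 with h | h
      · rw [abs_of_nonpos h, max_eq_right h]; ring
      · rw [abs_of_nonneg h, max_eq_left h]; ring
    simp_rw [e]
    rw [integral_sub (i3.const_mul 2) i2, integral_const_mul, integral_sub i1 (integrable_const _)]
    simp
    ring
  simp_rw [key]
  have := (hp.const_mul 2).add ((hq.sub hfu).add_const η)
  simpa using this

/-- A ball around a support point has positive mass. A deviation of `ε` at `u n - x` would, by the
Lipschitz bound, persist as `ε / 2` on a whole ball and contradict convergence in the mean. -/
lemma tendsto_sub_of_mem_support {f : ℝ → ℝ} {K : ℝ≥0} (hf : LipschitzWith K f) {B : ℝ}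
    (hB : ∀ t, |f t| ≤ B) (hd : Tendsto (fun t => f t - ∫ s, f (t - s) ∂ν) atTop (𝓝 0)) {η : ℝ}
    (hη : ∀ ε > 0, ∀ᶠ t in atTop, f t < η + ε) {u : ℕ → ℝ} (hu : Tendsto u atTop atTop)
    (hfu : Tendsto (fun n => f (u n)) atTop (𝓝 η)) {x : ℝ} (hx : x ∈ ν.support) :
    Tendsto (fun n => f (u n - x)) atTop (𝓝 η) := by
  have hL := tendsto_integral_abs_sub hf.continuous.measurable hB hd hη hu hfu
  rw [Metric.tendsto_atTop']
  intro ε hε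
  set ρ : ℝ := ε / (2 * (K + 1)) with hρ
  have hK : (0 : ℝ) ≤ K := K.2
  have hρ0 : 0 < ρ := by positivity
  have hKρ : K * ρ ≤ ε / 2 := by
    rw [hρ, mul_div_assoc', div_le_div_iff₀ (by positivity) (by positivity)]
    nlinarith
  have hc : 0 < ν.real (Metric.ball x ρ) :=
    ENNReal.toReal_pos ((Measure.mem_support_iff_forall x).1 hx _ (Metric.ball_mem_nhds x hρ0)).ne'
      (measure_ne_top _ _)
  obtain ⟨N, hN⟩ := eventually_atTop.1
    (hL.eventually (gt_mem_nhds (show 0 < ν.real (Metric.ball x ρ) * (ε / 2) by positivity)))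
  refine ⟨N, fun n hn => ?_⟩
  rw [Real.dist_eq]
  by_contra! hcon
  refine (hN n hn.le).not_ge ?_
  have i1 : Integrable (fun s => |f (u n - s) - η|) ν :=
    ((integrable_comp_sub hf.continuous.measurable hB (u n)).sub (integrable_const _)).abs
  calc ν.real (Metric.ball x ρ) * (ε / 2) = ∫ _ in Metric.ball x ρ, ε / 2 ∂ν := by simp
    _ ≤ ∫ s in Metric.ball x ρ, |f (u n - s) - η| ∂ν := by
        refine setIntegral_mono_on (integrable_const _).integrableOn i1.integrableOn
          Metric.isOpen_ball.measurableSet fun s hs => ?_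
        have h1 : |f (u n - x) - f (u n - s)| ≤ K * ρ := by
          have h2 := hf.dist_le_mul (u n - x) (u n - s)
          rw [Real.dist_eq] at h2
          refine h2.trans (mul_le_mul_of_nonneg_left ?_ hK)
          rw [dist_sub_left, dist_comm]
          exact (Metric.mem_ball.1 hs).le
        have h3 := abs_sub_le (f (u n - x)) (f (u n - s)) η
        linarith
    _ ≤ ∫ s, |f (u n - s) - η| ∂ν :=
        setIntegral_le_integral i1 (Eventually.of_forall fun s => abs_nonneg _)

/-- Every element of the additive subgroup generated by a set is a difference of two elements of
the additive submonoid it generates. -/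
lemma exists_sub_of_mem_closure {s : Set ℝ} {x : ℝ} (hx : x ∈ AddSubgroup.closure s) :
    ∃ p ∈ AddSubmonoid.closure s, ∃ q ∈ AddSubmonoid.closure s, x = p - q := by
  induction hx using AddSubgroup.closure_induction with
  | mem y hy => exact ⟨y, AddSubmonoid.subset_closure hy, 0, zero_mem _, by simp⟩
  | zero => exact ⟨0, zero_mem _, 0, zero_mem _, by simp⟩
  | add y z _ _ h1 h2 =>
    obtain ⟨p, hp, q, hq, rfl⟩ := h1
    obtain ⟨p', hp', q', hq', rfl⟩ := h2
    exact ⟨p + p', add_mem hp hp', q + q', add_mem hq hq', by ring⟩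
  | neg y _ h =>
    obtain ⟨p, hp, q, hq, rfl⟩ := h
    exact ⟨q, hq, p, hp, by ring⟩

/-- The additive submonoid generated by a set that lies in no grid through `0` contains two
distinct elements that are arbitrarily close. -/
lemma exists_close_of_not_zmultiples {s : Set ℝ} (hs : ¬ ∃ a : ℝ, ∀ x ∈ s, ∃ k : ℤ, x = a * k)
    {ε : ℝ} (hε : 0 < ε) :
    ∃ p ∈ AddSubmonoid.closure s, ∃ q ∈ AddSubmonoid.closure s, 0 < p - q ∧ p - q < ε := by
  rcases AddSubgroup.dense_or_cyclic (AddSubgroup.closure s) with h | ⟨a, ha⟩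
  · obtain ⟨x, hx, hx'⟩ := h.exists_mem_open isOpen_Ioo (Set.nonempty_Ioo.2 hε)
    obtain ⟨p, hp, q, hq, rfl⟩ := exists_sub_of_mem_closure hx
    exact ⟨p, hp, q, hq, hx'.1, hx'.2⟩
  · refine (hs ⟨a, fun x hx => ?_⟩).elim
    have : x ∈ AddSubgroup.closure {a} := ha ▸ AddSubgroup.subset_closure hx
    obtain ⟨k, hk⟩ := AddSubgroup.mem_closure_singleton.1 this
    exact ⟨k, by rw [← hk]; simp [mul_comm]⟩

/-- The upper limit of a bounded Lipschitz function with bounded sums along the progressions of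
difference `k` is at most `0`, if the function asymptotically equals its `ν`-average and `ν` is not
arithmetic. -/
lemma eventually_lt_of_tendsto_sub_integral {f : ℝ → ℝ} {K : ℝ≥0} (hf : LipschitzWith K f) {B : ℝ}
    (hB : ∀ t, |f t| ≤ B) (hd : Tendsto (fun t => f t - ∫ s, f (t - s) ∂ν) atTop (𝓝 0))
    (hν : ¬ ∃ a : ℝ, ∀ x ∈ ν.support, ∃ k : ℤ, x = a * k) {k M : ℝ} (hk : 0 ≤ k)
    (hM : ∀ t (m : ℕ), ∑ j ∈ Finset.range m, f (t - j * k) ≤ M) {ε : ℝ} (hε : 0 < ε) :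
    ∀ᶠ t in atTop, f t < ε := by
  set η := limsup f atTop with hηdef
  have hbdd : IsBoundedUnder (· ≤ ·) atTop f :=
    isBoundedUnder_of ⟨B, fun t => (abs_le.1 (hB t)).2⟩
  have hbdd' : IsBoundedUnder (· ≥ ·) atTop f :=
    isBoundedUnder_of ⟨-B, fun t => (abs_le.1 (hB t)).1⟩
  have hη : ∀ ε > 0, ∀ᶠ t in atTop, f t < η + ε := fun ε hε =>
    eventually_lt_of_limsup_lt (by linarith) hbdd
  suffices h0 : η ≤ 0 by
    filter_upwards [hη ε hε] with t ht
    linarith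
  by_contra! hpos
  obtain ⟨u, hu, hfu⟩ : ∃ u : ℕ → ℝ, Tendsto u atTop atTop ∧
      Tendsto (fun n => f (u n)) atTop (𝓝 η) := by
    obtain ⟨u, h1, h2⟩ := exists_seq_tendsto_limsup (f := atTop) (u := f)
      hbdd'.isCoboundedUnder_flip hbdd
    exact ⟨u, h2, h1⟩
  -- The sequence is quantified inside the claim, so that a second shift can be applied to the
  -- already shifted sequence.
  have hgood : ∀ x ∈ AddSubmonoid.closure ν.support, ∀ u : ℕ → ℝ, Tendsto u atTop atTop →
      Tendsto (fun n => f (u n)) atTop (𝓝 η) → Tendsto (fun n => f (u n - x)) atTop (𝓝 η) := by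
    intro x hx
    induction hx using AddSubmonoid.closure_induction with
    | mem x hx => exact fun u hu hfu => tendsto_sub_of_mem_support hf hB hd hη hu hfu hx
    | zero => intro u _ h; simpa using h
    | add x y _ _ h1 h2 =>
      intro u hu hfu
      have := h2 (fun n => u n - x) (tendsto_atTop_add_const_right _ _ hu) (h1 u hu hfu)
      simpa only [sub_sub] using this
  set δ : ℝ := η / (4 * (K + 1)) with hδ
  have hK : (0 : ℝ) ≤ K := K.2
  have hδ0 : 0 < δ := by positivity
  have hKδ : K * δ ≤ η / 4 := by
    rw [hδ, mul_div_assoc', div_le_div_iff₀ (by positivity) (by positivity)]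
    nlinarith
  obtain ⟨p, hp, q, hq, hpq, hpq'⟩ := exists_close_of_not_zmultiples hν hδ0
  -- `m` terms above `η / 2` exceed `M`. The semigroup elements `i * p + (n - i) * q` with `i ≤ n`
  -- form a grid of mesh `p - q < δ` starting at `n * q`; `n` is so large that it covers the length
  -- `m * k`. Each `n * q + j * k` is then within `δ` of a good shift.
  obtain ⟨m, hm⟩ := exists_nat_gt (2 * M / η)
  obtain ⟨n, hn⟩ := exists_nat_gt (m * k / (p - q))
  have hn' : m * k < n * (p - q) := (div_lt_iff₀ hpq).1 hn
  have hev : ∀ j ∈ Finset.range m, ∀ᶠ l in atTop, η / 2 < f (u l - n * q - j * k) := by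
    intro j hj
    have hjm : (j : ℝ) ≤ m := by exact_mod_cast (Finset.mem_range.1 hj).le
    set i := ⌊j * k / (p - q)⌋₊ with hi
    have hi1 : i * (p - q) ≤ j * k := by
      have := Nat.floor_le (show 0 ≤ j * k / (p - q) by positivity)
      rwa [le_div_iff₀ hpq] at this
    have hi2 : j * k < (i + 1) * (p - q) := by
      have := Nat.lt_floor_add_one (j * k / (p - q))
      rwa [div_lt_iff₀ hpq] at this
    have hin : i ≤ n := by
      have : (i : ℝ) * (p - q) < n * (p - q) := by nlinarith
      exact_mod_cast (lt_of_mul_lt_mul_right this hpq.le).le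
    have hmem : (i : ℝ) * p + (n - i : ℕ) * q ∈ AddSubmonoid.closure ν.support := by
      have := add_mem (AddSubmonoid.nsmul_mem _ hp i) (AddSubmonoid.nsmul_mem _ hq (n - i))
      simpa [nsmul_eq_mul] using this
    filter_upwards [(hgood _ hmem u hu hfu).eventually (lt_mem_nhds (show 3 * η / 4 < η by linarith))]
      with l hl
    have h2 := hf.dist_le_mul (u l - (i * p + (n - i : ℕ) * q)) (u l - n * q - j * k)
    rw [Real.dist_eq, Real.dist_eq] at h2
    have h3 : |u l - (i * p + (n - i : ℕ) * q) - (u l - n * q - j * k)| ≤ δ := by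
      rw [Nat.cast_sub hin, abs_le]
      constructor <;> nlinarith
    have h4 := h2.trans ((mul_le_mul_of_nonneg_left h3 hK).trans hKδ)
    linarith [(abs_le.1 h4).2]
  obtain ⟨l, hl⟩ := ((Finset.eventually_all _).2 hev).exists
  have h5 : ∑ j ∈ Finset.range m, η / 2 ≤ ∑ j ∈ Finset.range m, f (u l - n * q - j * k) :=
    Finset.sum_le_sum fun j hj => (hl j hj).le
  rw [Finset.sum_const, Finset.card_range, nsmul_eq_mul] at h5
  have h6 := h5.trans (hM (u l - n * q) m)
  rw [div_lt_iff₀ hpos] at hm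
  linarith

lemma tendsto_zero_of_tendsto_sub_integral {f : ℝ → ℝ} {K : ℝ≥0} (hf : LipschitzWith K f) {B : ℝ}
    (hB : ∀ t, |f t| ≤ B) (hd : Tendsto (fun t => f t - ∫ s, f (t - s) ∂ν) atTop (𝓝 0))
    (hν : ¬ ∃ a : ℝ, ∀ x ∈ ν.support, ∃ k : ℤ, x = a * k) {k M : ℝ} (hk : 0 ≤ k)
    (hM : ∀ t (m : ℕ), |∑ j ∈ Finset.range m, f (t - j * k)| ≤ M) :
    Tendsto f atTop (𝓝 0) := by
  rw [tendsto_order]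
  constructor
  · intro a ha
    have hd' : Tendsto (fun t => (-f) t - ∫ s, (-f) (t - s) ∂ν) atTop (𝓝 0) := by
      simpa [integral_neg, add_comm, sub_eq_add_neg] using hd.neg
    have := eventually_lt_of_tendsto_sub_integral hf.neg (by simpa using hB) hd' hν hk (M := M)
      (fun t m => by simpa using neg_le.1 (neg_le_of_abs_le (hM t m))) (neg_pos.2 ha)
    filter_upwards [this] with t ht
    simpa using ht
  · intro a ha
    exact eventually_lt_of_tendsto_sub_integral hf hB hd hν hk
      (fun t m => (le_abs_self _).trans (hM t m)) ha

end Renewal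

/-! ### The renewal theorem for the exponential kernel -/

section Renewal

lemma intervalIntegrable_of_bound {Z : ℝ → ℝ} (hm : Measurable Z) {C : ℝ} (hC : ∀ t, |Z t| ≤ C)
    (a b : ℝ) : IntervalIntegrable Z volume a b :=
  (intervalIntegrable_const (c := C)).mono_fun hm.aestronglyMeasurable
    (Eventually.of_forall fun t => by simpa using (hC t).trans (le_abs_self C))

/-- The integral of `Z` from `0`. -/
def primitive (Z : ℝ → ℝ) (t : ℝ) : ℝ := ∫ r in (0 : ℝ)..t, Z r

section Primitive

variable {Z : ℝ → ℝ} {C : ℝ}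

lemma primitive_sub (hm : Measurable Z) (hC : ∀ t, |Z t| ≤ C) (a b : ℝ) :
    primitive Z b - primitive Z a = ∫ r in a..b, Z r :=
  intervalIntegral.integral_interval_sub_left (intervalIntegrable_of_bound hm hC _ _)
    (intervalIntegrable_of_bound hm hC _ _)

lemma abs_primitive_sub_le (hm : Measurable Z) (hC : ∀ t, |Z t| ≤ C) (a b : ℝ) :
    |primitive Z b - primitive Z a| ≤ C * |b - a| := by
  rw [primitive_sub hm hC]
  exact intervalIntegral.norm_integral_le_of_norm_le_const (f := Z) fun r _ => hC r

lemma lipschitzWith_primitive (hm : Measurable Z) (hC : ∀ t, |Z t| ≤ C) :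
    LipschitzWith C.toNNReal (primitive Z) :=
  LipschitzWith.of_dist_le_mul fun a b => by
    rw [Real.coe_toNNReal _ ((abs_nonneg _).trans (hC 0))]
    exact abs_primitive_sub_le hm hC b a

lemma measurable_primitive (hm : Measurable Z) (hC : ∀ t, |Z t| ≤ C) :
    Measurable (primitive Z) :=
  (lipschitzWith_primitive hm hC).continuous.measurable

lemma primitive_of_neg (h0 : ∀ t < 0, Z t = 0) {t : ℝ} (ht : t ≤ 0) : primitive Z t = 0 := by
  rw [primitive, intervalIntegral.integral_symm, intervalIntegral.integral_of_le ht,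
    integral_Ioc_eq_integral_Ioo, setIntegral_eq_zero_of_forall_eq_zero fun r hr => h0 r hr.2,
    neg_zero]

variable {ν : Measure ℝ} [IsProbabilityMeasure ν]

lemma integrable_primitive_sub (hm : Measurable Z) (hC : ∀ t, |Z t| ≤ C)
    (hi : Integrable (fun s => s) ν) (t : ℝ) : Integrable (fun s => primitive Z (t - s)) ν := by
  refine Integrable.mono' (((integrable_const t).sub hi).abs.const_mul C)
    ((measurable_primitive hm hC).comp (measurable_const.sub measurable_id)).aestronglyMeasurable
    (Eventually.of_forall fun s => ?_)
  have := abs_primitive_sub_le hm hC 0 (t - s)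
  simpa [primitive] using this

lemma measurable_integral_sub (hm : Measurable Z) : Measurable fun t => ∫ s, Z (t - s) ∂ν := by
  have : StronglyMeasurable (Function.uncurry fun t s : ℝ => Z (t - s)) :=
    (hm.comp (measurable_fst.sub measurable_snd)).stronglyMeasurable
  exact this.integral_prod_right.measurable

lemma abs_integral_sub_le (hC : ∀ t, |Z t| ≤ C) (t : ℝ) : |∫ s, Z (t - s) ∂ν| ≤ C := by
  have := norm_integral_le_of_norm_le_const (μ := ν) (f := fun s => Z (t - s)) (C := C)
    (Eventually.of_forall fun s => hC (t - s))
  simpa using this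

/-- Integration commutes with `Z ↦ Z - Z * ν`. -/
lemma primitive_sub_integral (hm : Measurable Z) (hC : ∀ t, |Z t| ≤ C) (h0 : ∀ t < 0, Z t = 0)
    (hν : ∀ᵐ s ∂ν, 0 ≤ s) (t : ℝ) :
    primitive Z t - ∫ s, primitive Z (t - s) ∂ν
      = primitive (fun r => Z r - ∫ s, Z (r - s) ∂ν) t := by
  rcases lt_or_ge t 0 with ht | ht
  · rw [primitive_of_neg h0 ht.le, primitive_of_neg _ ht.le]
    · rw [integral_eq_zero_of_ae, sub_zero]
      filter_upwards [hν] with s hs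
      exact primitive_of_neg h0 (by linarith)
    · intro r hr
      rw [h0 r hr, integral_eq_zero_of_ae, sub_zero]
      filter_upwards [hν] with s hs
      exact h0 _ (by linarith)
  · rw [primitive, primitive, intervalIntegral.integral_sub (intervalIntegrable_of_bound hm hC _ _)
      (intervalIntegrable_of_bound (measurable_integral_sub hm) (abs_integral_sub_le hC) _ _),
      sub_right_inj, intervalIntegral.integral_of_le ht, integral_integral_swap]
    · refine integral_congr_ae ?_
      filter_upwards [hν] with s hs
      rw [← intervalIntegral.integral_of_le ht, intervalIntegral.integral_comp_sub_right,
        ← primitive_sub hm hC, zero_sub, primitive_of_neg h0 (neg_nonpos.2 hs), sub_zero]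
    · exact Integrable.of_bound
        (hm.comp (measurable_fst.sub measurable_snd)).aestronglyMeasurable C
        (Eventually.of_forall fun p => hC _)

end Primitive

/-- The exponential density. -/
def expKernel (t : ℝ) : ℝ := if 0 ≤ t then Real.exp (-t) else 0

lemma expKernel_of_nonneg {t : ℝ} (ht : 0 ≤ t) : expKernel t = Real.exp (-t) := if_pos ht

lemma expKernel_of_neg {t : ℝ} (ht : t < 0) : expKernel t = 0 := if_neg ht.not_ge

lemma measurable_expKernel : Measurable expKernel :=
  Measurable.ite measurableSet_Ici (Real.measurable_exp.comp measurable_neg) measurable_const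

lemma expKernel_nonneg (t : ℝ) : 0 ≤ expKernel t := by
  unfold expKernel; split_ifs <;> positivity

lemma abs_expKernel_le (t : ℝ) : |expKernel t| ≤ 1 := by
  rw [abs_of_nonneg (expKernel_nonneg t)]
  unfold expKernel
  split_ifs with h
  · exact Real.exp_le_one_iff.2 (by linarith)
  · exact zero_le_one

lemma primitive_expKernel {t : ℝ} (ht : 0 ≤ t) : primitive expKernel t = 1 - Real.exp (-t) := by
  have h : Set.EqOn expKernel (fun r => Real.exp (-r)) (Set.uIcc 0 t) := fun r hr => by
    rw [Set.uIcc_of_le ht] at hr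
    exact expKernel_of_nonneg hr.1
  rw [primitive, intervalIntegral.integral_congr h, intervalIntegral.integral_comp_neg]
  simp

lemma tendsto_primitive_expKernel : Tendsto (primitive expKernel) atTop (𝓝 1) := by
  have h : Tendsto (fun t : ℝ => 1 - Real.exp (-t)) atTop (𝓝 (1 - 0)) :=
    tendsto_const_nhds.sub Real.tendsto_exp_neg_atTop_nhds_zero
  rw [sub_zero] at h
  refine h.congr' ?_
  filter_upwards [eventually_ge_atTop 0] with t ht
  exact (primitive_expKernel ht).symm

variable {ν : Measure ℝ} [IsProbabilityMeasure ν] {Z : ℝ → ℝ} {C : ℝ}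

/-- A priori bound for subsolutions of the renewal equation. -/
lemma le_of_sub_integral_le_expKernel (hm : Measurable Z) (hC : ∀ t, |Z t| ≤ C)
    (h0 : ∀ t < 0, Z t = 0) (hpos : ∀ t, 0 ≤ Z t) (hmono : Monotone fun t => Real.exp t * Z t)
    (hν : ∀ᵐ s ∂ν, 0 ≤ s) (hi : Integrable (fun s => s) ν)
    (hle : ∀ t, Z t - ∫ s, Z (t - s) ∂ν ≤ expKernel t) {a : ℝ} (ha : 0 < a)
    (hc : 0 < ν.real (Set.Ici a)) (t : ℝ) : Z t ≤ Real.exp a / (a * ν.real (Set.Ici a)) := by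
  rcases lt_or_ge t 0 with ht | ht
  · rw [h0 t ht]; positivity
  have hT : 0 ≤ t + a := by linarith
  -- The inequality is integrated up to `t + a`, so that a step `s ≥ a` leaves the whole window `[t,
  -- t + a]` uncancelled. Monotonicity of `exp t * Z t` keeps `Z` above `exp (-a) * Z t` there. The
  -- resulting bound does not involve `C`.
  have h1 : primitive Z (t + a) - ∫ s, primitive Z (t + a - s) ∂ν ≤ 1 := by
    rw [primitive_sub_integral hm hC h0 hν]
    calc _ ≤ primitive expKernel (t + a) := by
          refine intervalIntegral.integral_mono_on hT ?_
            (intervalIntegrable_of_bound measurable_expKernel abs_expKernel_le _ _)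
            fun r _ => hle r
          exact (intervalIntegrable_of_bound hm hC _ _).sub
            (intervalIntegrable_of_bound (measurable_integral_sub hm) (abs_integral_sub_le hC) _ _)
      _ ≤ 1 := by
          rw [primitive_expKernel hT]
          linarith [Real.exp_pos (-(t + a))]
  have hIi := integrable_primitive_sub hm hC hi (t + a)
  have hJ : Integrable (fun s => primitive Z (t + a) - primitive Z (t + a - s)) ν :=
    (integrable_const _).sub hIi
  have h2 : primitive Z (t + a) - ∫ s, primitive Z (t + a - s) ∂ν
      = ∫ s, (primitive Z (t + a) - primitive Z (t + a - s)) ∂ν := by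
    rw [integral_sub (integrable_const _) hIi]; simp
  have hincr : ∀ x y, x ≤ y → 0 ≤ primitive Z y - primitive Z x := fun x y hxy => by
    rw [primitive_sub hm hC]
    exact intervalIntegral.integral_nonneg hxy fun r _ => hpos r
  have h3 : ∀ s ∈ Set.Ici a, a * Real.exp (-a) * Z t
      ≤ primitive Z (t + a) - primitive Z (t + a - s) := by
    intro s hs
    have h4 : a * Real.exp (-a) * Z t ≤ primitive Z (t + a) - primitive Z t := by
      rw [primitive_sub hm hC]
      have : ∫ _ in t..(t + a), Real.exp (-a) * Z t ≤ ∫ r in t..(t + a), Z r := by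
        refine intervalIntegral.integral_mono_on (by linarith) intervalIntegrable_const
          (intervalIntegrable_of_bound hm hC _ _) fun r hr => ?_
        have h5 : Real.exp t * Z t ≤ Real.exp r * Z r := hmono hr.1
        have h6 : Real.exp r * Z r ≤ Real.exp (t + a) * Z r :=
          mul_le_mul_of_nonneg_right (Real.exp_le_exp.2 hr.2) (hpos r)
        have h7 : Real.exp t * Z t ≤ Real.exp t * (Real.exp a * Z r) := by
          rw [← mul_assoc, ← Real.exp_add]; exact h5.trans h6
        have h8 := le_of_mul_le_mul_left h7 (Real.exp_pos t)
        rwa [Real.exp_neg, inv_mul_le_iff₀ (Real.exp_pos a)]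
      rw [intervalIntegral.integral_const, smul_eq_mul, add_sub_cancel_left] at this
      rwa [mul_assoc]
    have h9 := hincr (t + a - s) t (by linarith [Set.mem_Ici.1 hs])
    linarith
  have h4 : ν.real (Set.Ici a) * (a * Real.exp (-a) * Z t) ≤ 1 := by
    calc ν.real (Set.Ici a) * (a * Real.exp (-a) * Z t)
        = ∫ _ in Set.Ici a, a * Real.exp (-a) * Z t ∂ν := by simp
      _ ≤ ∫ s in Set.Ici a, (primitive Z (t + a) - primitive Z (t + a - s)) ∂ν :=
          setIntegral_mono_on (integrable_const _).integrableOn hJ.integrableOn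
            measurableSet_Ici h3
      _ ≤ ∫ s, (primitive Z (t + a) - primitive Z (t + a - s)) ∂ν := by
          refine setIntegral_le_integral hJ ?_
          filter_upwards [hν] with s hs
          exact hincr _ _ (by linarith)
      _ ≤ 1 := h2 ▸ h1
  rw [le_div_iff₀ (by positivity)]
  have h5 := mul_le_mul_of_nonneg_left h4 (Real.exp_pos a).le
  have h6 : Real.exp a * Real.exp (-a) = 1 := by rw [← Real.exp_add]; simp
  calc Z t * (a * ν.real (Set.Ici a))
      = (Real.exp a * Real.exp (-a)) * (Z t * (a * ν.real (Set.Ici a))) := by rw [h6, one_mul]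
    _ = Real.exp a * (ν.real (Set.Ici a) * (a * Real.exp (-a) * Z t)) := by ring
    _ ≤ Real.exp a := by simpa using h5

/-- The increments of the primitive over intervals of a fixed length converge. -/
lemma tendsto_primitive_increment (hm : Measurable Z) (hC : ∀ t, |Z t| ≤ C)
    (h0 : ∀ t < 0, Z t = 0) (hν : ∀ᵐ s ∂ν, 0 ≤ s) (hi : Integrable (fun s => s) ν)
    (heq : ∀ t, Z t - ∫ s, Z (t - s) ∂ν = expKernel t)
    (hna : ¬ ∃ a : ℝ, ∀ x ∈ ν.support, ∃ k : ℤ, x = a * k) {h : ℝ} (hh : 0 ≤ h) :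
    Tendsto (fun t => (∫ s, s ∂ν) * (primitive Z t - primitive Z (t - h))) atTop (𝓝 h) := by
  set D : ℝ → ℝ := fun t => primitive Z t - primitive Z (t - h) with hDdef
  have hDm : Measurable D := (measurable_primitive hm hC).sub
    ((measurable_primitive hm hC).comp (measurable_id.sub_const h))
  have hDb : ∀ t, |D t| ≤ C * h := fun t => by
    have := abs_primitive_sub_le hm hC (t - h) t
    rwa [sub_sub_cancel, abs_of_nonneg hh] at this
  have hD0 : ∀ t < 0, D t = 0 := fun t ht => by
    simp only [hDdef]
    rw [primitive_of_neg h0 ht.le, primitive_of_neg h0 (by linarith), sub_zero]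
  have hDL : LipschitzWith (C.toNNReal + C.toNNReal) D := by
    have h1 := lipschitzWith_primitive hm hC
    have h2 : LipschitzWith C.toNNReal fun t => primitive Z (t - h) :=
      LipschitzWith.of_dist_le_mul fun x y => by
        simpa using h1.dist_le_mul (x - h) (y - h)
    exact h1.sub h2
  have hDd : ∀ t, D t - ∫ s, D (t - s) ∂ν = primitive expKernel t - primitive expKernel (t - h) := by
    intro t
    have e : (fun r => Z r - ∫ s, Z (r - s) ∂ν) = expKernel := funext heq
    have e1 := primitive_sub_integral hm hC h0 hν t
    have e2 := primitive_sub_integral hm hC h0 hν (t - h)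
    rw [e] at e1 e2
    rw [← e1, ← e2]
    have e3 : ∀ s, D (t - s) = primitive Z (t - s) - primitive Z (t - h - s) := fun s => by
      simp only [hDdef]; ring_nf
    simp_rw [e3]
    rw [integral_sub (integrable_primitive_sub hm hC hi _) (integrable_primitive_sub hm hC hi _)]
    simp only [hDdef]
    ring
  have hGt : ∀ c : ℝ, Tendsto (fun t => primitive expKernel (t + c)) atTop (𝓝 1) := fun c =>
    tendsto_primitive_expKernel.comp (tendsto_atTop_add_const_right _ _ tendsto_id)
  have hDt : Tendsto (fun t => D t - ∫ s, D (t - s) ∂ν) atTop (𝓝 0) := by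
    simp_rw [hDd]
    simpa [sub_eq_add_neg] using tendsto_primitive_expKernel.sub (hGt (-h))
  -- The sums of `D (t + k) - D t` along a progression of difference `k` telescope, so they are
  -- bounded as the criterion for convergence to `0` requires.
  have hslow : ∀ k ≥ 0, Tendsto (fun t => D (t + k) - D t) atTop (𝓝 0) := by
    intro k hk
    have hsh : LipschitzWith (C.toNNReal + C.toNNReal) fun t => D (t + k) :=
      LipschitzWith.of_dist_le_mul fun x y => by simpa using hDL.dist_le_mul (x + k) (y + k)
    refine tendsto_zero_of_tendsto_sub_integral (hsh.sub hDL) (B := C * h + C * h)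
      (fun t => (abs_sub _ _).trans (add_le_add (hDb _) (hDb _))) ?_ hna hk
      (M := C * h + C * h) ?_
    · have h1 : Tendsto (fun t => t + k) atTop atTop := tendsto_atTop_add_const_right _ _ tendsto_id
      have := (hDt.comp h1).sub hDt
      rw [sub_zero] at this
      refine this.congr fun t => ?_
      have e : ∀ s, D (t - s + k) = D (t + k - s) := fun s => by ring_nf
      simp_rw [e]
      rw [integral_sub (integrable_comp_sub hDm hDb _) (integrable_comp_sub hDm hDb _)]
      simp only [Function.comp]
      ring
    · intro t m
      have e : ∀ j : ℕ, D (t - j * k + k) - D (t - j * k)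
          = D (t + k - j * k) - D (t + k - (j + 1 : ℕ) * k) := fun j => by
        push_cast; ring_nf
      simp_rw [e]
      rw [Finset.sum_range_sub' fun j : ℕ => D (t + k - j * k)]
      exact (abs_sub _ _).trans (add_le_add (hDb _) (hDb _))
  have hslow' : ∀ r ≥ 0, Tendsto (fun t => D (t - r) - D t) atTop (𝓝 0) := by
    intro r hr
    have h1 : Tendsto (fun t => t - r) atTop atTop := tendsto_atTop_add_const_right _ _ tendsto_id
    have := ((hslow r hr).comp h1).neg
    simpa [Function.comp_def] using this
  -- Slow variation makes the integral of `D` over `[t - s, t]` asymptotic to `s * D t`; averaging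
  -- over `ν` brings out the mean step.
  have hinner : ∀ s ≥ 0, Tendsto (fun t => primitive D t - primitive D (t - s) - s * D t) atTop
      (𝓝 0) := by
    intro s hs
    have e : ∀ t, primitive D t - primitive D (t - s) - s * D t
        = ∫ r in (0 : ℝ)..s, (D (t - r) - D t) := by
      intro t
      rw [intervalIntegral.integral_sub, intervalIntegral.integral_comp_sub_left,
        primitive_sub hDm hDb]
      · simp
      · exact intervalIntegrable_of_bound (hDm.comp (measurable_const.sub measurable_id))
          (fun r => hDb _) _ _
      · exact intervalIntegrable_const
    simp_rw [e]
    have : Tendsto (fun t => ∫ r in (0 : ℝ)..s, (D (t - r) - D t)) atTop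
        (𝓝 (∫ _ in (0 : ℝ)..s, (0 : ℝ))) := by
      refine intervalIntegral.tendsto_integral_filter_of_dominated_convergence
        (fun _ => C * h + C * h) (Eventually.of_forall fun t => ?_)
        (Eventually.of_forall fun t => Eventually.of_forall fun r _ => ?_)
        intervalIntegrable_const (Eventually.of_forall fun r hr => ?_)
      · exact ((hDm.comp (measurable_const.sub measurable_id)).sub_const _).aestronglyMeasurable
      · exact (abs_sub _ _).trans (add_le_add (hDb _) (hDb _))
      · rw [Set.uIoc_of_le hs] at hr
        exact hslow' r hr.1.le
    simpa using this
  have hlim : Tendsto (fun t => ∫ s, (primitive D t - primitive D (t - s) - s * D t) ∂ν) atTop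
      (𝓝 (∫ _, (0 : ℝ) ∂ν)) := by
    refine tendsto_integral_filter_of_dominated_convergence (fun s => 2 * (C * h) * |s|)
      (Eventually.of_forall fun t => ?_) (Eventually.of_forall fun t => ?_) (hi.abs.const_mul _) ?_
    · exact (((measurable_const.sub ((measurable_primitive hDm hDb).comp
        (measurable_const.sub measurable_id))).sub
        (measurable_id.mul_const _))).aestronglyMeasurable
    · refine Eventually.of_forall fun s => ?_
      have h1 := abs_primitive_sub_le hDm hDb (t - s) t
      rw [sub_sub_cancel] at h1
      have h2 : |s * D t| ≤ |s| * (C * h) := by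
        rw [abs_mul]; exact mul_le_mul_of_nonneg_left (hDb t) (abs_nonneg s)
      refine (abs_sub _ _).trans ?_
      linarith
    · filter_upwards [hν] with s hs
      exact hinner s hs
  have hE : Tendsto (fun t => ∫ r in (t - h)..t, primitive expKernel r) atTop (𝓝 h) := by
    have hGm := measurable_primitive measurable_expKernel abs_expKernel_le
    have h1 : ∀ t, ∫ r in (t - h)..t, primitive expKernel r
        = ∫ r in (0 : ℝ)..h, primitive expKernel (t - r) := fun t => by
      rw [intervalIntegral.integral_comp_sub_left, sub_zero]
    simp_rw [h1]
    have h2 : Tendsto (fun t => ∫ r in (0 : ℝ)..h, primitive expKernel (t - r)) atTop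
        (𝓝 (∫ _ in (0 : ℝ)..h, (1 : ℝ))) := by
      refine intervalIntegral.tendsto_integral_filter_of_dominated_convergence
        (fun _ => 1) (Eventually.of_forall fun t => ?_) ?_
        intervalIntegrable_const (Eventually.of_forall fun r _ => ?_)
      · exact (hGm.comp (measurable_const.sub measurable_id)).aestronglyMeasurable
      · filter_upwards [eventually_ge_atTop h] with t ht
        refine Eventually.of_forall fun r hr => ?_
        rw [Set.uIoc_of_le hh] at hr
        rw [primitive_expKernel (by linarith [hr.2]), Real.norm_eq_abs, abs_le]
        have h3 := Real.exp_pos (-(t - r))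
        have h4 : Real.exp (-(t - r)) ≤ 1 := Real.exp_le_one_iff.2 (by linarith [hr.2])
        constructor <;> linarith
      · simpa [sub_eq_add_neg] using hGt (-r)
    simpa using h2
  -- The integrated equation for `D` has right-hand side the integral of `primitive expKernel` over
  -- `[t - h, t]`, which tends to `h`.
  have hid : ∀ᶠ t in atTop, (∫ s, s ∂ν) * D t = (∫ r in (t - h)..t, primitive expKernel r)
      - ∫ s, (primitive D t - primitive D (t - s) - s * D t) ∂ν := by
    refine Eventually.of_forall fun t => ?_
    have i1 := integrable_primitive_sub hDm hDb hi t
    have e1 := primitive_sub_integral hDm hDb hD0 hν t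
    simp_rw [hDd] at e1
    have hGc := (lipschitzWith_primitive measurable_expKernel abs_expKernel_le).continuous
    have e2 : primitive (fun r => primitive expKernel r - primitive expKernel (r - h)) t
        = ∫ r in (t - h)..t, primitive expKernel r := by
      have c2 : Continuous fun r => primitive expKernel (r - h) := hGc.comp (continuous_sub_right h)
      rw [primitive, intervalIntegral.integral_sub (hGc.intervalIntegrable _ _)
        (c2.intervalIntegrable _ _), intervalIntegral.integral_comp_sub_right, zero_sub,
        ← intervalIntegral.integral_interval_sub_left (hGc.intervalIntegrable 0 t)
          (hGc.intervalIntegrable 0 (t - h))]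
      congr 1
      rw [← intervalIntegral.integral_add_adjacent_intervals (hGc.intervalIntegrable (-h) 0)
        (hGc.intervalIntegrable 0 (t - h)), add_eq_right, ← neg_eq_zero,
        ← intervalIntegral.integral_symm]
      have : Set.EqOn (primitive expKernel) (fun _ => 0) (Set.uIcc 0 (-h)) := fun r hr => by
        rw [Set.uIcc_of_ge (neg_nonpos.2 hh)] at hr
        exact primitive_of_neg (fun _ => expKernel_of_neg) hr.2
      rw [intervalIntegral.integral_congr this]
      simp
    have i2 : Integrable (fun s => primitive D t - primitive D (t - s)) ν :=
      (integrable_const _).sub i1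
    rw [← e2, ← e1, integral_sub i2 (hi.mul_const _), integral_sub (integrable_const _) i1,
      integral_mul_const]
    simp
  refine Tendsto.congr' (hid.mono fun t ht => ht.symm) ?_
  simpa using hE.sub hlim

/-- The renewal theorem for the exponential kernel. -/
theorem tendsto_of_renewal_equation (hm : Measurable Z) (hC : ∀ t, |Z t| ≤ C)
    (h0 : ∀ t < 0, Z t = 0) (hpos : ∀ t, 0 ≤ Z t) (hmono : Monotone fun t => Real.exp t * Z t)
    (hν : ∀ᵐ s ∂ν, 0 ≤ s) (hi : Integrable (fun s => s) ν) (hmean : 0 < ∫ s, s ∂ν)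
    (heq : ∀ t, Z t - ∫ s, Z (t - s) ∂ν = expKernel t)
    (hna : ¬ ∃ a : ℝ, ∀ x ∈ ν.support, ∃ k : ℤ, x = a * k) :
    Tendsto Z atTop (𝓝 (∫ s, s ∂ν)⁻¹) := by
  set m := ∫ s, s ∂ν with hmdef
  have hD : ∀ h > 0, Tendsto (fun t => (primitive Z t - primitive Z (t - h)) / h) atTop (𝓝 m⁻¹) := by
    intro h hh
    have := (tendsto_primitive_increment hm hC h0 hν hi heq hna hh.le).const_mul (m⁻¹ / h)
    rw [div_mul_cancel₀ _ hh.ne'] at this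
    refine this.congr fun t => ?_
    rw [← hmdef]
    field_simp
  -- A Tauberian step: up to factors `exp h`, `Z t` lies between its means over `[t - h, t]` and
  -- `[t, t + h]`. Both means tend to `m⁻¹`, and then `h` is taken small.
  have hZ : ∀ r t, r ≤ t → Z r ≤ Real.exp (t - r) * Z t := fun r t hrt => by
    have h1 : Real.exp r * Z r ≤ Real.exp t * Z t := hmono hrt
    have h2 : Real.exp r * Z r ≤ Real.exp r * (Real.exp (t - r) * Z t) := by
      rwa [← mul_assoc, ← Real.exp_add, add_sub_cancel]
    exact le_of_mul_le_mul_left h2 (Real.exp_pos r)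
  have hup : ∀ h > 0, ∀ t, (primitive Z t - primitive Z (t - h)) / h ≤ Real.exp h * Z t := by
    intro h hh t
    rw [div_le_iff₀ hh, primitive_sub hm hC]
    have : ∫ r in (t - h)..t, Z r ≤ ∫ _ in (t - h)..t, Real.exp h * Z t := by
      refine intervalIntegral.integral_mono_on (by linarith)
        (intervalIntegrable_of_bound hm hC _ _) intervalIntegrable_const fun r hr => ?_
      exact (hZ r t hr.2).trans (mul_le_mul_of_nonneg_right
        (Real.exp_le_exp.2 (by linarith [hr.1])) (hpos t))
    rwa [intervalIntegral.integral_const, smul_eq_mul, sub_sub_cancel, mul_comm h] at this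
  have hlow : ∀ h > 0, ∀ t,
      Real.exp (-h) * Z t ≤ (primitive Z (t + h) - primitive Z (t + h - h)) / h := by
    intro h hh t
    rw [le_div_iff₀ hh, primitive_sub hm hC, add_sub_cancel_right]
    have : ∫ _ in t..(t + h), Real.exp (-h) * Z t ≤ ∫ r in t..(t + h), Z r := by
      refine intervalIntegral.integral_mono_on (by linarith) intervalIntegrable_const
        (intervalIntegrable_of_bound hm hC _ _) fun r hr => ?_
      rw [Real.exp_neg, inv_mul_le_iff₀ (Real.exp_pos h)]
      exact (hZ t r hr.1).trans (mul_le_mul_of_nonneg_right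
        (Real.exp_le_exp.2 (by linarith [hr.2])) (hpos r))
    rwa [intervalIntegral.integral_const, smul_eq_mul, add_sub_cancel_left, mul_comm h] at this
  have hcont : ∀ c : ℝ, Tendsto (fun h : ℝ => Real.exp (c * h) * m⁻¹) (𝓝[>] 0) (𝓝 m⁻¹) := by
    intro c
    have h1 : Continuous fun h : ℝ => Real.exp (c * h) * m⁻¹ := by fun_prop
    have := (h1.tendsto 0).mono_left (nhdsWithin_le_nhds (s := Set.Ioi 0))
    simpa using this
  rw [tendsto_order]
  constructor
  · intro a ha
    obtain ⟨h, hah, hh⟩ := (((hcont (-1)).eventually (lt_mem_nhds ha)).and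
      self_mem_nhdsWithin).exists
    have hh : 0 < h := hh
    have h1 := ((hD h hh).const_mul (Real.exp (-1 * h))).eventually (lt_mem_nhds hah)
    filter_upwards [h1] with t ht
    refine ht.trans_le ?_
    have := mul_le_mul_of_nonneg_left (hup h hh t) (Real.exp_pos (-1 * h)).le
    simpa [← mul_assoc, ← Real.exp_add] using this
  · intro a ha
    obtain ⟨h, hah, hh⟩ := (((hcont 1).eventually (gt_mem_nhds ha)).and
      self_mem_nhdsWithin).exists
    have hh : 0 < h := hh
    have h2 := (hD h hh).comp (tendsto_atTop_add_const_right _ h tendsto_id)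
    have h1 := (h2.const_mul (Real.exp (1 * h))).eventually (gt_mem_nhds hah)
    filter_upwards [h1] with t ht
    refine lt_of_le_of_lt ?_ ht
    have := mul_le_mul_of_nonneg_left (hlow h hh t) (Real.exp_pos (1 * h)).le
    simpa [← mul_assoc, ← Real.exp_add] using this

end Renewal

/-! ### The law of one size-biased step -/

section StepMeasure

variable {V Ω : Type*} [Fintype V] [MeasurableSpace Ω] {Pr : Measure Ω}
  {β : List V → Ω → V → ℝ}

/-- The law of `-log β_x` when the token `x` is drawn from the next-token distribution. -/
def stepMeasure (β : List V → Ω → V → ℝ) (Pr : Measure Ω) : Measure ℝ :=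
  Measure.sum fun x : V =>
    (Pr.withDensity fun ω => ENNReal.ofReal (β [] ω x)).map fun ω => -Real.log (β [] ω x)

namespace IsIIDModel

lemma measurable_apply (hβ : IsIIDModel β Pr) (w : List V) (x : V) : Measurable fun ω => β w ω x :=
  (measurable_pi_apply x).comp (hβ.measurable w)

lemma nonneg (hβ : IsIIDModel β Pr) (w : List V) (ω : Ω) (x : V) : 0 ≤ β w ω x :=
  (hβ.mem_simplex w ω).1 x

lemma sum_eq_one (hβ : IsIIDModel β Pr) (w : List V) (ω : Ω) : ∑ x, β w ω x = 1 :=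
  (hβ.mem_simplex w ω).2

lemma le_one (hβ : IsIIDModel β Pr) (w : List V) (ω : Ω) (x : V) : β w ω x ≤ 1 :=
  hβ.sum_eq_one w ω ▸ Finset.single_le_sum (fun y _ => hβ.nonneg w ω y) (Finset.mem_univ x)

lemma neg_log_nonneg (hβ : IsIIDModel β Pr) (w : List V) (ω : Ω) (x : V) :
    0 ≤ -Real.log (β w ω x) :=
  neg_nonneg.2 (Real.log_nonpos (hβ.nonneg w ω x) (hβ.le_one w ω x))

lemma measurable_neg_log (hβ : IsIIDModel β Pr) (w : List V) (x : V) :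
    Measurable fun ω => -Real.log (β w ω x) :=
  (Real.measurable_log.comp (hβ.measurable_apply w x)).neg

lemma lintegral_stepMeasure (hβ : IsIIDModel β Pr) {F : ℝ → ℝ≥0∞} (hF : Measurable F) :
    ∫⁻ s, F s ∂(stepMeasure β Pr)
      = ∑ x, ∫⁻ ω, ENNReal.ofReal (β [] ω x) * F (-Real.log (β [] ω x)) ∂Pr := by
  rw [stepMeasure, lintegral_sum_measure, tsum_fintype]
  refine Finset.sum_congr rfl fun x _ => ?_
  rw [lintegral_map hF (hβ.measurable_neg_log [] x)]
  exact lintegral_withDensity_eq_lintegral_mul _ (hβ.measurable_apply [] x).ennreal_ofReal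
    (hF.comp (hβ.measurable_neg_log [] x))

/-- The density `β_x` discards tokens of probability `0`, for which the convention `Real.log 0 = 0`
would create a spurious point at `0`. -/
lemma ae_stepMeasure_iff (hβ : IsIIDModel β Pr) {p : ℝ → Prop} (hp : MeasurableSet {s | p s}) :
    (∀ᵐ s ∂(stepMeasure β Pr), p s)
      ↔ ∀ x, ∀ᵐ ω ∂Pr, 0 < β [] ω x → p (-Real.log (β [] ω x)) := by
  rw [stepMeasure, Measure.ae_sum_iff]
  refine forall_congr' fun x => ?_
  rw [ae_map_iff (hβ.measurable_neg_log [] x).aemeasurable hp,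
    ae_withDensity_iff (hβ.measurable_apply [] x).ennreal_ofReal]
  simp [not_le]

lemma isProbabilityMeasure_stepMeasure [IsProbabilityMeasure Pr] (hβ : IsIIDModel β Pr) :
    IsProbabilityMeasure (stepMeasure β Pr) := by
  constructor
  have := hβ.lintegral_stepMeasure (F := fun _ => 1) measurable_const
  simp only [lintegral_const, one_mul, mul_one] at this
  rw [this, ← lintegral_finsetSum _ fun x _ => (hβ.measurable_apply [] x).ennreal_ofReal]
  have e : ∀ ω, ∑ x, ENNReal.ofReal (β [] ω x) = 1 := fun ω => by
    rw [← ENNReal.ofReal_sum_of_nonneg fun x _ => hβ.nonneg [] ω x, hβ.sum_eq_one]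
    simp
  simp [e]

lemma ae_nonneg_stepMeasure (hβ : IsIIDModel β Pr) : ∀ᵐ s ∂(stepMeasure β Pr), 0 ≤ s :=
  (hβ.ae_stepMeasure_iff measurableSet_Ici).2 fun x =>
    Eventually.of_forall fun ω _ => hβ.neg_log_nonneg [] ω x

lemma isArithmetic_of_stepMeasure (hβ : IsIIDModel β Pr) {a : ℝ}
    (h : ∀ᵐ s ∂(stepMeasure β Pr), ∃ k : ℤ, s = a * k) : IsArithmetic (logPoints β) Pr := by
  have hm : MeasurableSet {s : ℝ | ∃ k : ℤ, s = a * k} := by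
    have : {s : ℝ | ∃ k : ℤ, s = a * k} = Set.range fun k : ℤ => a * k := by
      ext s; simp [eq_comm]
    rw [this]
    exact (Set.countable_range _).measurableSet
  have h1 := ae_all_iff.2 ((hβ.ae_stepMeasure_iff hm).1 h)
  rcases eq_or_ne a 0 with rfl | ha
  -- If `a = 0`, all points are `0` and lie in a grid of any mesh.
  · refine ⟨1, one_pos, 0, ?_⟩
    filter_upwards [h1] with ω hω
    rintro y ⟨x, hx, rfl⟩
    obtain ⟨k, hk⟩ := hω x hx
    exact ⟨0, by simpa using hk⟩
  · refine ⟨|a|, abs_pos.2 ha, 0, ?_⟩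
    filter_upwards [h1] with ω hω
    rintro y ⟨x, hx, rfl⟩
    obtain ⟨k, hk⟩ := hω x hx
    rcases abs_choice a with h | h
    · exact ⟨k, by rw [hk, h]; ring⟩
    · exact ⟨-k, by rw [hk, h]; push_cast; ring⟩

lemma not_support_stepMeasure (hβ : IsIIDModel β Pr) (hna : ¬ IsArithmetic (logPoints β) Pr) :
    ¬ ∃ a : ℝ, ∀ s ∈ (stepMeasure β Pr).support, ∃ k : ℤ, s = a * k := by
  rintro ⟨a, ha⟩
  refine hna (hβ.isArithmetic_of_stepMeasure (a := a) ?_)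
  filter_upwards [(stepMeasure β Pr).support_mem_ae] with s hs
  exact ha s hs

lemma mul_ofReal_neg_log (hβ : IsIIDModel β Pr) (ω : Ω) (x : V) :
    ENNReal.ofReal (β [] ω x) * ENNReal.ofReal (-Real.log (β [] ω x))
      = ENNReal.ofReal (Real.negMulLog (β [] ω x)) := by
  rw [← ENNReal.ofReal_mul (hβ.nonneg [] ω x), Real.negMulLog]
  congr 1
  ring

lemma negMulLog_nonneg (hβ : IsIIDModel β Pr) (ω : Ω) (x : V) :
    0 ≤ Real.negMulLog (β [] ω x) :=
  Real.negMulLog_nonneg (hβ.nonneg [] ω x) (hβ.le_one [] ω x)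

lemma integrable_stepMeasure [IsProbabilityMeasure Pr] (hβ : IsIIDModel β Pr) :
    Integrable (fun s => s) (stepMeasure β Pr) := by
  refine ⟨measurable_id.aestronglyMeasurable, ?_⟩
  rw [hasFiniteIntegral_iff_norm]
  have e : ∫⁻ s, ENNReal.ofReal ‖s‖ ∂(stepMeasure β Pr)
      = ∑ x, ∫⁻ ω, ENNReal.ofReal (Real.negMulLog (β [] ω x)) ∂Pr := by
    rw [hβ.lintegral_stepMeasure measurable_norm.ennreal_ofReal]
    refine Finset.sum_congr rfl fun x _ => lintegral_congr fun ω => ?_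
    rw [Real.norm_of_nonneg (hβ.neg_log_nonneg [] ω x), hβ.mul_ofReal_neg_log]
  rw [e]
  -- Finiteness of `V` suffices: each term satisfies `-y log y ≤ 1 - y ≤ 1`.
  refine ENNReal.sum_lt_top.2 fun x _ => lt_of_le_of_lt (lintegral_mono fun ω => ?_)
    (show ∫⁻ _, (1 : ℝ≥0∞) ∂Pr < ∞ by simp)
  refine ENNReal.ofReal_le_one.2 ?_
  linarith [Real.negMulLog_le_one_sub_self (hβ.nonneg [] ω x), hβ.nonneg [] ω x]

lemma integral_stepMeasure (hβ : IsIIDModel β Pr) :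
    ∫ s, s ∂(stepMeasure β Pr) = meanEntropy β Pr := by
  have hm : ∀ x, Measurable fun ω => Real.negMulLog (β [] ω x) := fun x =>
    Real.continuous_negMulLog.measurable.comp (hβ.measurable_apply [] x)
  have e : ∀ ω, -∑ x, β [] ω x * Real.log (β [] ω x) = ∑ x, Real.negMulLog (β [] ω x) := fun ω => by
    rw [← Finset.sum_neg_distrib]
    exact Finset.sum_congr rfl fun x _ => by rw [Real.negMulLog, neg_mul]
  rw [meanEntropy, integral_eq_lintegral_of_nonneg_ae hβ.ae_nonneg_stepMeasure
    measurable_id.aestronglyMeasurable, hβ.lintegral_stepMeasure ENNReal.measurable_ofReal]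
  simp_rw [e, hβ.mul_ofReal_neg_log]
  rw [integral_eq_lintegral_of_nonneg_ae
    (Eventually.of_forall fun ω => Finset.sum_nonneg fun x _ => hβ.negMulLog_nonneg ω x)
    (Finset.measurable_sum _ fun x _ => hm x).aestronglyMeasurable,
    ← lintegral_finsetSum _ fun x _ => (hm x).ennreal_ofReal]
  simp_rw [ENNReal.ofReal_sum_of_nonneg fun x _ => hβ.negMulLog_nonneg _ x]

/-- Otherwise the step is almost surely `0`, and a process with all its points at `0` is arithmetic.
-/
lemma exists_stepMeasure_Ici_pos [IsProbabilityMeasure Pr] (hβ : IsIIDModel β Pr)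
    (hna : ¬ IsArithmetic (logPoints β) Pr) : ∃ a > 0, stepMeasure β Pr (Set.Ici a) ≠ 0 := by
  by_contra! hcon
  refine hna (hβ.isArithmetic_of_stepMeasure (a := 0) ?_)
  have h1 : stepMeasure β Pr (⋃ n : ℕ, Set.Ici (1 / ((n : ℝ) + 1))) = 0 :=
    measure_iUnion_null fun n => hcon _ (by positivity)
  have h2 : ∀ᵐ s ∂(stepMeasure β Pr), s ∉ ⋃ n : ℕ, Set.Ici (1 / ((n : ℝ) + 1)) :=
    measure_eq_zero_iff_ae_notMem.1 h1
  filter_upwards [h2, hβ.ae_nonneg_stepMeasure] with s hs hs0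
  refine ⟨0, ?_⟩
  rw [zero_mul]
  refine le_antisymm (not_lt.1 fun hpos => hs ?_) hs0
  obtain ⟨n, hn⟩ := exists_nat_one_div_lt hpos
  exact Set.mem_iUnion.2 ⟨n, hn.le⟩

lemma meanEntropy_pos [IsProbabilityMeasure Pr] (hβ : IsIIDModel β Pr)
    (hna : ¬ IsArithmetic (logPoints β) Pr) : 0 < meanEntropy β Pr := by
  rw [← hβ.integral_stepMeasure, integral_pos_iff_support_of_nonneg_ae hβ.ae_nonneg_stepMeasure
    hβ.integrable_stepMeasure]
  obtain ⟨a, ha, h⟩ := hβ.exists_stepMeasure_Ici_pos hna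
  refine (pos_iff_ne_zero.2 h).trans_le (measure_mono fun s hs => ?_)
  exact (ha.trans_le hs).ne'

end IsIIDModel

end StepMeasure

/-! ### Path probabilities and the last step of a word -/

section PathProb

variable {V Ω : Type*} [MeasurableSpace Ω] {Pr : Measure Ω} {β : List V → Ω → V → ℝ}

lemma pathProb_nil (e : Env V) : pathProb e [] = 1 := by simp [pathProb]

lemma pathProb_concat (e : Env V) (w : List V) (x : V) :
    pathProb e (w ++ [x]) = pathProb e w * e w x := by
  have hl : w.length + 1 = (w ++ [x]).length := by simp
  unfold pathProb
  rw [← Equiv.prod_comp (finCongr hl), Fin.prod_univ_castSucc]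
  congr 1
  · refine Finset.prod_congr rfl fun i _ => ?_
    have hi : (i : ℕ) < w.length := i.2
    simp [List.take_append_of_le_length hi.le, List.getElem_append_left hi]
  · simp

/-- Words with `P(w) = 0` satisfy neither side, so extended reals are not needed from here on. -/
lemma position_le_iff (e : Env V) (w : List V) (t : ℝ) :
    position e w ≤ (t : EReal) ↔ Real.exp (-t) ≤ pathProb e w := by
  rw [position, ENNReal.log_ofReal]
  split_ifs with h
  · simp only [EReal.neg_bot, top_le_iff, EReal.coe_ne_top, false_iff, not_le]
    exact h.trans_lt (Real.exp_pos _)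
  · rw [← EReal.coe_neg, EReal.coe_le_coe_iff, neg_le, Real.le_log_iff_exp_le (not_le.1 h)]

/-- The probability that the position of `w` is at most `t`. -/
def reachProb (β : List V → Ω → V → ℝ) (Pr : Measure Ω) (w : List V) (t : ℝ) : ℝ≥0∞ :=
  Pr {ω | Real.exp (-t) ≤ pathProb (env β ω) w}

lemma reachProb_mono (w : List V) : Monotone (reachProb β Pr w) := fun _ _ h =>
  measure_mono fun _ hω => (Real.exp_le_exp.2 (neg_le_neg h)).trans hω

lemma nodeCount_eq_tsum (e : Env V) (t : ℝ) :
    nodeCount e t = ∑' w : List V, {w | Real.exp (-t) ≤ pathProb e w}.indicator 1 w := by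
  rw [nodeCount, ← ENNReal.tsum_set_one, ← tsum_subtype]
  exact tsum_congr_set_coe (fun _ => 1) (Set.ext fun w => position_le_iff e w t)

lemma reachProb_nil [IsProbabilityMeasure Pr] (t : ℝ) :
    reachProb β Pr [] t = if 0 ≤ t then 1 else 0 := by
  unfold reachProb
  simp_rw [pathProb_nil, Real.exp_le_one_iff, neg_nonpos]
  split_ifs with h <;> simp [h]

/-- The discounted expected number of nodes with position at most `t`. -/
def renewalFn (β : List V → Ω → V → ℝ) (Pr : Measure Ω) (t : ℝ) : ℝ :=
  Real.exp (-t) * (∫⁻ ω, nodeCount (env β ω) t ∂Pr).toReal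

lemma renewalFn_nonneg (t : ℝ) : 0 ≤ renewalFn β Pr t :=
  mul_nonneg (Real.exp_pos _).le ENNReal.toReal_nonneg

lemma exp_mul_renewalFn (t : ℝ) :
    Real.exp t * renewalFn β Pr t = (∫⁻ ω, nodeCount (env β ω) t ∂Pr).toReal := by
  rw [renewalFn, ← mul_assoc, ← Real.exp_add, add_neg_cancel, Real.exp_zero, one_mul]

end PathProb

variable {V Ω : Type*} [Fintype V] [MeasurableSpace Ω] {Pr : Measure Ω}
  {β : List V → Ω → V → ℝ}

namespace IsIIDModel

lemma measurable_pathProb (hβ : IsIIDModel β Pr) (w : List V) :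
    Measurable fun ω => pathProb (env β ω) w :=
  Finset.measurable_prod _ fun i _ => hβ.measurable_apply (w.take i) (w.get i)

lemma pathProb_nonneg (hβ : IsIIDModel β Pr) (w : List V) (ω : Ω) : 0 ≤ pathProb (env β ω) w :=
  Finset.prod_nonneg fun i _ => hβ.nonneg (w.take i) ω (w.get i)

lemma pathProb_le_one (hβ : IsIIDModel β Pr) (w : List V) (ω : Ω) : pathProb (env β ω) w ≤ 1 :=
  Finset.prod_le_one (fun i _ => hβ.nonneg (w.take i) ω (w.get i))
    fun i _ => hβ.le_one (w.take i) ω (w.get i)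

lemma measurableSet_reach (hβ : IsIIDModel β Pr) (w : List V) (t : ℝ) :
    MeasurableSet {ω | Real.exp (-t) ≤ pathProb (env β ω) w} :=
  measurableSet_le measurable_const (hβ.measurable_pathProb w)

/-- The probability of a word does not depend on the distribution at its last node. -/
lemma indepFun_pathProb (hβ : IsIIDModel β Pr) (w : List V) (x : V) :
    IndepFun (fun ω => pathProb (env β ω) w) (fun ω => β w ω x) Pr := by
  classical
  set S : Finset (List V) := Finset.univ.image fun i : Fin w.length => w.take i with hS
  have hST : Disjoint S {w} := by
    rw [Finset.disjoint_singleton_right, hS, Finset.mem_image]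
    rintro ⟨i, -, hi⟩
    have h1 := congrArg List.length hi
    have h2 := i.2
    simp only [List.length_take] at h1
    omega
  have hmem : ∀ i : Fin w.length, w.take i ∈ S := fun i =>
    Finset.mem_image_of_mem _ (Finset.mem_univ i)
  have h := iIndepFun.indepFun_finset S {w} hST hβ.indep hβ.measurable
  have hφ : Measurable fun g : S → V → ℝ => ∏ i : Fin w.length, g ⟨w.take i, hmem i⟩ (w.get i) :=
    Finset.measurable_prod _ fun i _ =>
      (measurable_pi_apply (w.get i)).comp (measurable_pi_apply (⟨w.take i, hmem i⟩ : S))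
  have hψ : Measurable fun g : ({w} : Finset (List V)) → V → ℝ =>
      g ⟨w, Finset.mem_singleton_self w⟩ x :=
    (measurable_pi_apply x).comp (measurable_pi_apply _)
  exact h.comp hφ hψ

lemma reachProb_of_neg (hβ : IsIIDModel β Pr) (w : List V) {t : ℝ} (ht : t < 0) :
    reachProb β Pr w t = 0 := by
  have : {ω | Real.exp (-t) ≤ pathProb (env β ω) w} = ∅ := by
    refine Set.eq_empty_of_forall_notMem fun ω hω => ?_
    have h1 : 1 < Real.exp (-t) := Real.one_lt_exp_iff.2 (by linarith)
    exact (h1.trans_le hω).not_ge (hβ.pathProb_le_one w ω)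
  rw [reachProb, this, measure_empty]

variable [IsProbabilityMeasure Pr]

/-- One step of the branching random walk. -/
lemma reachProb_concat (hβ : IsIIDModel β Pr) (w : List V) (x : V) (t : ℝ) :
    reachProb β Pr (w ++ [x]) t = ∫⁻ ω, {ω | 0 < β [] ω x}.indicator
      (fun ω => reachProb β Pr w (t + Real.log (β [] ω x))) ω ∂Pr := by
  have hp := hβ.measurable_pathProb w
  have hb := hβ.measurable_apply w x
  have hlaw : Measure.map (fun ω => β w ω x) Pr = Measure.map (fun ω => β [] ω x) Pr :=
    ((hβ.ident w).comp (measurable_pi_apply x)).map_eq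
  have hS : MeasurableSet {q : ℝ × ℝ | Real.exp (-t) ≤ q.1 * q.2} :=
    measurableSet_le measurable_const (measurable_fst.mul measurable_snd)
  have h1 : reachProb β Pr (w ++ [x]) t
      = Measure.map (fun ω => (pathProb (env β ω) w, β w ω x)) Pr
        {q : ℝ × ℝ | Real.exp (-t) ≤ q.1 * q.2} := by
    rw [Measure.map_apply (hp.prodMk hb) hS, reachProb]
    simp_rw [pathProb_concat]
    rfl
  -- Cutting at the last letter needs only the independence of `P(w)` and `β w`, not that of whole
  -- subtrees. Identical distribution then replaces `β w` by the root distribution.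
  rw [h1, (indepFun_iff_map_prod_eq_prod_map_map hp.aemeasurable hb.aemeasurable).1
    (hβ.indepFun_pathProb w x), hlaw, Measure.prod_apply_symm hS,
    lintegral_map (measurable_measure_prodMk_right hS) (hβ.measurable_apply [] x)]
  refine lintegral_congr fun ω => ?_
  have hm : MeasurableSet ((fun p : ℝ => (p, β [] ω x)) ⁻¹' {q : ℝ × ℝ | Real.exp (-t) ≤ q.1 * q.2}) :=
    (measurable_id.prodMk measurable_const) hS
  rw [Measure.map_apply hp hm]
  by_cases h : 0 < β [] ω x
  · rw [Set.indicator_of_mem (show ω ∈ {ω | 0 < β [] ω x} from h), reachProb]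
    congr 1
    ext ω'
    simp only [Set.mem_preimage, Set.mem_ofPred_eq]
    rw [neg_add, Real.exp_add, Real.exp_neg (Real.log _), Real.exp_log h, ← div_eq_mul_inv,
      div_le_iff₀ h]
  · rw [Set.indicator_of_notMem (show ω ∉ {ω | 0 < β [] ω x} from h)]
    have : (fun ω' => pathProb (env β ω') w) ⁻¹' ((fun p : ℝ => (p, β [] ω x)) ⁻¹'
        {q : ℝ × ℝ | Real.exp (-t) ≤ q.1 * q.2}) = ∅ := by
      refine Set.eq_empty_of_forall_notMem fun ω' hω' => ?_
      have h2 : Real.exp (-t) ≤ pathProb (env β ω') w * β [] ω x := hω'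
      exact (Real.exp_pos (-t)).not_ge
        (h2.trans (mul_nonpos_of_nonneg_of_nonpos (hβ.pathProb_nonneg w ω') (not_lt.1 h)))
    rw [this, measure_empty]

end IsIIDModel

/-- The expected number of nodes of generation `n` with position at most `t`. -/
def levelCount (β : List V → Ω → V → ℝ) (Pr : Measure Ω) (n : ℕ) (t : ℝ) : ℝ≥0∞ :=
  ∑ v : Fin n → V, reachProb β Pr (List.ofFn v) t

lemma levelCount_mono (n : ℕ) : Monotone (levelCount β Pr n) := fun _ _ h =>
  Finset.sum_le_sum fun v _ => reachProb_mono (List.ofFn v) h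

/-- The discounted expected number of nodes of generation `n` with position at most `t`. -/
def levelFn (β : List V → Ω → V → ℝ) (Pr : Measure Ω) (n : ℕ) (t : ℝ) : ℝ≥0∞ :=
  ENNReal.ofReal (Real.exp (-t)) * levelCount β Pr n t

lemma measurable_levelFn (n : ℕ) : Measurable (levelFn β Pr n) :=
  (Real.measurable_exp.comp measurable_neg).ennreal_ofReal.mul (levelCount_mono n).measurable

lemma exp_mul_levelFn (n : ℕ) (t : ℝ) :
    Real.exp t * (levelFn β Pr n t).toReal = (levelCount β Pr n t).toReal := by
  rw [levelFn, ENNReal.toReal_mul, ENNReal.toReal_ofReal (Real.exp_pos _).le, ← mul_assoc,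
    ← Real.exp_add]
  simp

/-! ### The many-to-one formula and the renewal equation for the node count -/

namespace IsIIDModel

lemma lintegral_nodeCount_eq_tsum (hβ : IsIIDModel β Pr) (t : ℝ) :
    ∫⁻ ω, nodeCount (env β ω) t ∂Pr = ∑' w, reachProb β Pr w t := by
  simp_rw [nodeCount_eq_tsum]
  have hm : ∀ w : List V, Measurable fun ω =>
      ({w | Real.exp (-t) ≤ pathProb (env β ω) w}.indicator 1 w : ℝ≥0∞) := fun w =>
    (measurable_one.indicator (hβ.measurableSet_reach w t) :
      Measurable ({ω | Real.exp (-t) ≤ pathProb (env β ω) w}.indicator (1 : Ω → ℝ≥0∞)))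
  rw [lintegral_tsum fun w => (hm w).aemeasurable]
  exact tsum_congr fun w => (lintegral_indicator_one (hβ.measurableSet_reach w t) :
    ∫⁻ ω, ({ω | Real.exp (-t) ≤ pathProb (env β ω) w}.indicator (1 : Ω → ℝ≥0∞)) ω ∂Pr = _)

/-- The expected number of nodes with position at most `t`, generation by generation. -/
lemma lintegral_nodeCount (hβ : IsIIDModel β Pr) (t : ℝ) :
    ∫⁻ ω, nodeCount (env β ω) t ∂Pr = ∑' n, levelCount β Pr n t := by
  rw [hβ.lintegral_nodeCount_eq_tsum, ← Equiv.tsum_eq (List.equivSigmaTuple (α := V)).symm,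
    ENNReal.tsum_sigma']
  refine tsum_congr fun n => ?_
  rw [tsum_fintype]
  rfl

lemma ofReal_exp_mul_lintegral_nodeCount (hβ : IsIIDModel β Pr) (t : ℝ) :
    ENNReal.ofReal (Real.exp (-t)) * ∫⁻ ω, nodeCount (env β ω) t ∂Pr = ∑' n, levelFn β Pr n t := by
  rw [hβ.lintegral_nodeCount, ← ENNReal.tsum_mul_left]
  rfl

lemma renewalFn_eq (hβ : IsIIDModel β Pr) (t : ℝ) :
    renewalFn β Pr t = (∑' n, levelFn β Pr n t).toReal := by
  rw [← hβ.ofReal_exp_mul_lintegral_nodeCount, ENNReal.toReal_mul,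
    ENNReal.toReal_ofReal (Real.exp_pos _).le, renewalFn]

lemma levelFn_of_neg (hβ : IsIIDModel β Pr) (n : ℕ) {t : ℝ} (ht : t < 0) :
    levelFn β Pr n t = 0 := by
  rw [levelFn, levelCount, Finset.sum_eq_zero fun v _ => hβ.reachProb_of_neg _ ht, mul_zero]

lemma measurable_renewalFn (hβ : IsIIDModel β Pr) : Measurable (renewalFn β Pr) := by
  rw [funext hβ.renewalFn_eq]
  exact (Measurable.tsum fun n => measurable_levelFn n).ennreal_toReal

lemma renewalFn_of_neg (hβ : IsIIDModel β Pr) {t : ℝ} (ht : t < 0) : renewalFn β Pr t = 0 := by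
  rw [hβ.renewalFn_eq]
  simp_rw [hβ.levelFn_of_neg _ ht]
  simp

variable [IsProbabilityMeasure Pr]

lemma levelCount_succ (hβ : IsIIDModel β Pr) (n : ℕ) (t : ℝ) :
    levelCount β Pr (n + 1) t = ∑ x, ∫⁻ ω, {ω | 0 < β [] ω x}.indicator
      (fun ω => levelCount β Pr n (t + Real.log (β [] ω x))) ω ∂Pr := by
  have hm : ∀ (v : Fin n → V) (x : V), Measurable ({ω | 0 < β [] ω x}.indicator
      (fun ω => reachProb β Pr (List.ofFn v) (t + Real.log (β [] ω x)))) := fun v x =>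
    ((reachProb_mono (List.ofFn v)).measurable.comp
      (measurable_const.add (Real.measurable_log.comp (hβ.measurable_apply [] x)))).indicator
      (measurableSet_lt measurable_const (hβ.measurable_apply [] x))
  have e : ∀ (x : V) (v : Fin n → V), List.ofFn (Fin.snocEquiv (fun _ => V) (x, v))
      = List.ofFn v ++ [x] := fun x v => by
    rw [List.ofFn_succ_last]
    simp [Fin.snocEquiv]
  unfold levelCount
  rw [← Equiv.sum_comp (Fin.snocEquiv fun _ => V), Fintype.sum_prod_type]
  refine Finset.sum_congr rfl fun x _ => ?_
  simp_rw [e, hβ.reachProb_concat]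
  rw [← lintegral_finsetSum _ fun v _ => hm v x]
  refine lintegral_congr fun ω => ?_
  by_cases h : ω ∈ {ω | 0 < β [] ω x}
  · simp_rw [Set.indicator_of_mem h]
  · simp_rw [Set.indicator_of_notMem h]
    simp

lemma levelFn_zero (t : ℝ) : levelFn β Pr 0 t = ENNReal.ofReal (expKernel t) := by
  rw [levelFn, levelCount, Fintype.sum_unique, List.ofFn_zero, reachProb_nil, expKernel]
  split_ifs <;> simp

/-- The many-to-one formula. -/
lemma levelFn_succ (hβ : IsIIDModel β Pr) (n : ℕ) (t : ℝ) :
    levelFn β Pr (n + 1) t = ∫⁻ s, levelFn β Pr n (t - s) ∂(stepMeasure β Pr) := by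
  rw [hβ.lintegral_stepMeasure (F := fun s => levelFn β Pr n (t - s))
    ((measurable_levelFn n).comp (measurable_const.sub measurable_id)),
    levelFn, hβ.levelCount_succ, Finset.mul_sum]
  refine Finset.sum_congr rfl fun x _ => ?_
  rw [← lintegral_const_mul' _ _ ENNReal.ofReal_ne_top]
  refine lintegral_congr fun ω => ?_
  -- Since `exp (-t) = β_x * exp (-(t + log β_x))`, the discount supplies exactly the weight `β_x`
  -- of the size-biased step.
  by_cases h : 0 < β [] ω x
  · rw [Set.indicator_of_mem (show ω ∈ {ω | 0 < β [] ω x} from h), levelFn, sub_neg_eq_add,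
      ← mul_assoc, ← ENNReal.ofReal_mul h.le, neg_add, Real.exp_add, Real.exp_neg (Real.log _),
      Real.exp_log h]
    congr 2
    field_simp
  · rw [Set.indicator_of_notMem (show ω ∉ {ω | 0 < β [] ω x} from h),
      ENNReal.ofReal_of_nonpos (not_lt.1 h)]
    simp

lemma levelFn_le_one (hβ : IsIIDModel β Pr) (n : ℕ) (t : ℝ) : levelFn β Pr n t ≤ 1 := by
  have := hβ.isProbabilityMeasure_stepMeasure
  induction n generalizing t with
  | zero =>
    rw [levelFn_zero]
    exact ENNReal.ofReal_le_one.2 ((le_abs_self _).trans (abs_expKernel_le t))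
  | succ n ih =>
    rw [hβ.levelFn_succ]
    exact (lintegral_mono fun s => ih (t - s)).trans (by simp)

lemma toReal_levelFn_succ (hβ : IsIIDModel β Pr) (n : ℕ) (t : ℝ) :
    (levelFn β Pr (n + 1) t).toReal
      = ∫ s, (levelFn β Pr n (t - s)).toReal ∂(stepMeasure β Pr) := by
  rw [hβ.levelFn_succ, integral_toReal]
  · exact ((measurable_levelFn n).comp (measurable_const.sub measurable_id)).aemeasurable
  · exact Eventually.of_forall fun s => (hβ.levelFn_le_one n _).trans_lt ENNReal.one_lt_top

lemma levelCount_ne_top (n : ℕ) (t : ℝ) : levelCount β Pr n t ≠ ∞ :=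
  ENNReal.sum_ne_top.2 fun _ _ => measure_ne_top _ _

/-- The partial sums of the generations are uniformly bounded. -/
lemma exists_sum_levelFn_le (hβ : IsIIDModel β Pr) (hna : ¬ IsArithmetic (logPoints β) Pr) :
    ∃ C : ℝ, ∀ (N : ℕ) (t : ℝ), ∑ n ∈ Finset.range N, levelFn β Pr n t ≤ ENNReal.ofReal C := by
  have := hβ.isProbabilityMeasure_stepMeasure
  obtain ⟨a, ha, hpos⟩ := hβ.exists_stepMeasure_Ici_pos hna
  have hc : 0 < (stepMeasure β Pr).real (Set.Ici a) :=
    ENNReal.toReal_pos hpos (measure_ne_top _ _)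
  have hfin : ∀ n t, levelFn β Pr n t ≠ ∞ := fun n t =>
    ((hβ.levelFn_le_one n t).trans_lt ENNReal.one_lt_top).ne
  have hle : ∀ n t, (levelFn β Pr n t).toReal ≤ 1 := fun n t =>
    ENNReal.toReal_mono ENNReal.one_ne_top (hβ.levelFn_le_one n t)
  have hm : ∀ n, Measurable fun t => (levelFn β Pr n t).toReal := fun n =>
    (measurable_levelFn n).ennreal_toReal
  have habs : ∀ n t, |(levelFn β Pr n t).toReal| ≤ 1 := fun n t => by
    rw [abs_of_nonneg ENNReal.toReal_nonneg]; exact hle n t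
  refine ⟨Real.exp a / (a * (stepMeasure β Pr).real (Set.Ici a)), fun N t => ?_⟩
  rw [← ENNReal.ofReal_toReal (ENNReal.sum_ne_top.2 fun n _ => hfin n t)]
  refine ENNReal.ofReal_le_ofReal ?_
  rw [ENNReal.toReal_sum fun n _ => hfin n t]
  -- The crude bound `N` on the partial sum only serves to make the a priori estimate applicable;
  -- the resulting constant is free of `N`.
  refine le_of_sub_integral_le_expKernel (ν := stepMeasure β Pr)
    (Z := fun t => ∑ n ∈ Finset.range N, (levelFn β Pr n t).toReal) (C := N)
    (Finset.measurable_sum _ fun n _ => hm n) (fun t => ?_) (fun t ht => ?_)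
    (fun t => Finset.sum_nonneg fun n _ => ENNReal.toReal_nonneg) (fun s t hst => ?_)
    hβ.ae_nonneg_stepMeasure hβ.integrable_stepMeasure (fun t => ?_) ha hc t
  · refine (Finset.abs_sum_le_sum_abs _ _).trans ((Finset.sum_le_sum fun n _ => habs n t).trans ?_)
    simp
  · exact Finset.sum_eq_zero fun n _ => by rw [hβ.levelFn_of_neg n ht, ENNReal.toReal_zero]
  · simp only [Finset.mul_sum, exp_mul_levelFn]
    exact Finset.sum_le_sum fun n _ =>
      ENNReal.toReal_mono (levelCount_ne_top n t) (levelCount_mono n hst)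
  · rw [integral_finsetSum _ fun n _ => integrable_comp_sub (hm n) (habs n) t,
      ← Finset.sum_sub_distrib]
    simp_rw [← hβ.toReal_levelFn_succ]
    -- Convolution shifts the generation by one, so the difference telescopes to generation `0`
    -- minus generation `N`; dropping the latter leaves at most `expKernel`.
    rw [Finset.sum_range_sub' fun n => (levelFn β Pr n t).toReal, levelFn_zero,
      ENNReal.toReal_ofReal (expKernel_nonneg t)]
    linarith [ENNReal.toReal_nonneg (a := levelFn β Pr N t)]

lemma exists_tsum_levelFn_le (hβ : IsIIDModel β Pr) (hna : ¬ IsArithmetic (logPoints β) Pr) :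
    ∃ C : ℝ, 0 ≤ C ∧ ∀ t : ℝ, ∑' n, levelFn β Pr n t ≤ ENNReal.ofReal C := by
  obtain ⟨C, hC⟩ := hβ.exists_sum_levelFn_le hna
  refine ⟨max C 0, le_max_right _ _, fun t => ?_⟩
  exact (ENNReal.tsum_le_of_sum_range_le fun N => hC N t).trans
    (ENNReal.ofReal_le_ofReal (le_max_left _ _))

lemma lintegral_nodeCount_ne_top (hβ : IsIIDModel β Pr) (hna : ¬ IsArithmetic (logPoints β) Pr)
    (t : ℝ) : ∫⁻ ω, nodeCount (env β ω) t ∂Pr ≠ ∞ := by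
  intro h
  obtain ⟨C, -, hC⟩ := hβ.exists_tsum_levelFn_le hna
  have h1 := hC t
  rw [← hβ.ofReal_exp_mul_lintegral_nodeCount, h, ENNReal.mul_top
    (ENNReal.ofReal_pos.2 (Real.exp_pos _)).ne', top_le_iff] at h1
  exact ENNReal.ofReal_ne_top h1

lemma exists_abs_renewalFn_le (hβ : IsIIDModel β Pr) (hna : ¬ IsArithmetic (logPoints β) Pr) :
    ∃ C : ℝ, ∀ t, |renewalFn β Pr t| ≤ C := by
  obtain ⟨C, hC0, hC⟩ := hβ.exists_tsum_levelFn_le hna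
  refine ⟨C, fun t => ?_⟩
  rw [abs_of_nonneg (renewalFn_nonneg t), hβ.renewalFn_eq]
  exact ENNReal.toReal_le_of_le_ofReal hC0 (hC t)

/-- The expected number of nodes satisfies a renewal equation. -/
lemma renewalFn_sub_integral (hβ : IsIIDModel β Pr) (hna : ¬ IsArithmetic (logPoints β) Pr)
    (t : ℝ) : renewalFn β Pr t - ∫ s, renewalFn β Pr (t - s) ∂(stepMeasure β Pr) = expKernel t := by
  obtain ⟨C, hC0, hC⟩ := hβ.exists_tsum_levelFn_le hna
  have hfin : ∀ t, ∑' n, levelFn β Pr n t < ∞ := fun t => (hC t).trans_lt ENNReal.ofReal_lt_top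
  have hm : ∀ n, Measurable fun s => levelFn β Pr n (t - s) := fun n =>
    (measurable_levelFn n).comp (measurable_const.sub measurable_id)
  simp_rw [hβ.renewalFn_eq]
  rw [integral_toReal (Measurable.tsum hm).aemeasurable
    (Eventually.of_forall fun s => hfin (t - s)), lintegral_tsum fun n => (hm n).aemeasurable]
  simp_rw [← hβ.levelFn_succ]
  have h1 : ∑' n, levelFn β Pr n t = levelFn β Pr 0 t + ∑' n, levelFn β Pr (n + 1) t :=
    tsum_eq_zero_add' ENNReal.summable
  have h2 := hfin t
  rw [h1] at h2
  rw [h1, ENNReal.toReal_add (ENNReal.add_lt_top.1 h2).1.ne (ENNReal.add_lt_top.1 h2).2.ne,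
    add_sub_cancel_right, levelFn_zero, ENNReal.toReal_ofReal (expKernel_nonneg t)]

lemma tendsto_renewalFn (hβ : IsIIDModel β Pr) (hna : ¬ IsArithmetic (logPoints β) Pr) :
    Tendsto (renewalFn β Pr) atTop (𝓝 (meanEntropy β Pr)⁻¹) := by
  have := hβ.isProbabilityMeasure_stepMeasure
  obtain ⟨C, hC⟩ := hβ.exists_abs_renewalFn_le hna
  have hμ := hβ.meanEntropy_pos hna
  rw [← hβ.integral_stepMeasure] at hμ ⊢
  refine tendsto_of_renewal_equation hβ.measurable_renewalFn hC (fun t => hβ.renewalFn_of_neg)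
    renewalFn_nonneg (fun s t hst => ?_) hβ.ae_nonneg_stepMeasure hβ.integrable_stepMeasure hμ
    (hβ.renewalFn_sub_integral hna) (hβ.not_support_stepMeasure hna)
  simp only [exp_mul_renewalFn, hβ.lintegral_nodeCount]
  refine ENNReal.toReal_mono ?_ (ENNReal.tsum_le_tsum fun n => levelCount_mono n hst)
  rw [← hβ.lintegral_nodeCount]
  exact hβ.lintegral_nodeCount_ne_top hna t

/-- The expected number of nodes with position at most `t` is asymptotically `exp t / μ`. -/
theorem lintegral_nodeCount_sub_isLittleO (hβ : IsIIDModel β Pr)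
    (hna : ¬ IsArithmetic (logPoints β) Pr) :
    (fun t : ℝ => (∫⁻ ω, nodeCount (env β ω) t ∂Pr).toReal
      - Real.exp t / meanEntropy β Pr) =o[atTop] Real.exp := by
  rw [isLittleO_iff_tendsto fun t h => ((Real.exp_pos t).ne' h).elim]
  have h1 := (hβ.tendsto_renewalFn hna).sub_const (meanEntropy β Pr)⁻¹
  rw [sub_self] at h1
  refine h1.congr fun t => ?_
  have h2 := (Real.exp_pos t).ne'
  rw [← exp_mul_renewalFn]
  field_simp

end IsIIDModel

/-- The mean of a bounded function over `[0, t]` converges to its limit at infinity. -/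
lemma primitive_sub_isLittleO {Z : ℝ → ℝ} (hm : Measurable Z) {C : ℝ} (hC : ∀ t, |Z t| ≤ C) {c : ℝ}
    (hZ : Tendsto Z atTop (𝓝 c)) : (fun t => primitive Z t - t * c) =o[atTop] fun t => t := by
  -- Rescaling to `[0, 1]` turns the mean over `[0, t]` into a case of dominated convergence.
  have h1 : Tendsto (fun t => ∫ u in (0 : ℝ)..1, Z (t * u)) atTop
      (𝓝 (∫ _ in (0 : ℝ)..1, c)) := by
    refine intervalIntegral.tendsto_integral_filter_of_dominated_convergence (fun _ => C)
      (Eventually.of_forall fun t => ?_)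
      (Eventually.of_forall fun t => Eventually.of_forall fun u _ => hC _)
      intervalIntegrable_const (Eventually.of_forall fun u hu => ?_)
    · exact (hm.comp (measurable_const.mul measurable_id)).aestronglyMeasurable
    · rw [Set.uIoc_of_le zero_le_one] at hu
      exact hZ.comp (tendsto_id.atTop_mul_const hu.1)
  refine isLittleO_of_tendsto' ?_ ?_
  · filter_upwards [eventually_gt_atTop 0] with t ht h
    exact (ht.ne' h).elim
  · have h2 := h1.sub_const c
    simp only [intervalIntegral.integral_const, sub_zero, one_smul, sub_self] at h2
    refine h2.congr' ?_
    filter_upwards [eventually_gt_atTop 0] with t ht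
    rw [intervalIntegral.integral_comp_mul_left _ ht.ne', mul_zero, mul_one, smul_eq_mul,
      ← primitive]
    field_simp

lemma lintegral_exp_neg {a b : ℝ} (hab : a ≤ b) :
    ∫⁻ s in Set.Ioc a b, ENNReal.ofReal (Real.exp (-s))
      = ENNReal.ofReal (Real.exp (-a) - Real.exp (-b)) := by
  have hc : Continuous fun s : ℝ => Real.exp (-s) := by fun_prop
  rw [← ofReal_integral_eq_lintegral_ofReal
    (hc.integrableOn_Icc.mono_set Set.Ioc_subset_Icc_self)
    (Eventually.of_forall fun s => (Real.exp_pos _).le), ← intervalIntegral.integral_of_le hab,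
    intervalIntegral.integral_comp_neg, integral_exp]

/-- A probability is a mixture of the indicators of the events that it exceeds a level. -/
lemma ofReal_le_add_lintegral {p : ℝ} (hp : p ≤ 1) (t : ℝ) :
    ENNReal.ofReal p ≤ ENNReal.ofReal (Real.exp (-t)) + ∫⁻ s in Set.Ioc 0 t,
      ENNReal.ofReal (Real.exp (-s)) * {s | Real.exp (-s) ≤ p}.indicator 1 s := by
  rcases le_or_gt p (Real.exp (-t)) with h | h
  · exact (ENNReal.ofReal_le_ofReal h).trans le_self_add
  have hp0 : 0 < p := (Real.exp_pos _).trans h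
  have hv0 : 0 ≤ -Real.log p := neg_nonneg.2 (Real.log_nonpos hp0.le hp)
  have hvt : -Real.log p ≤ t := by
    rw [neg_le]; exact ((Real.lt_log_iff_exp_lt hp0).2 h).le
  -- The excess `p - exp (-t)` is the integral of `exp (-s)` from `-log p` to `t`, where the
  -- indicator equals `1`.
  have h1 : ENNReal.ofReal (p - Real.exp (-t)) ≤ ∫⁻ s in Set.Ioc 0 t,
      ENNReal.ofReal (Real.exp (-s)) * {s | Real.exp (-s) ≤ p}.indicator 1 s := by
    calc ENNReal.ofReal (p - Real.exp (-t))
        = ∫⁻ s in Set.Ioc (-Real.log p) t, ENNReal.ofReal (Real.exp (-s)) := by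
          rw [lintegral_exp_neg hvt, neg_neg, Real.exp_log hp0]
      _ = ∫⁻ s in Set.Ioc (-Real.log p) t,
            ENNReal.ofReal (Real.exp (-s)) * {s | Real.exp (-s) ≤ p}.indicator 1 s := by
          refine setLIntegral_congr_fun measurableSet_Ioc fun s hs => ?_
          have : s ∈ {s | Real.exp (-s) ≤ p} :=
            (Real.le_log_iff_exp_le hp0).1 (by linarith [hs.1])
          simp only [Set.indicator_of_mem this, Pi.one_apply, mul_one]
      _ ≤ _ := lintegral_mono_set (Set.Ioc_subset_Ioc_left hv0)
  calc ENNReal.ofReal p = ENNReal.ofReal (Real.exp (-t) + (p - Real.exp (-t))) := by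
        rw [add_sub_cancel]
    _ ≤ _ := ENNReal.ofReal_add_le.trans (add_le_add_right h1 _)

/-! ### Accepted nodes of a draft tree -/

section Accepted

variable {V : Type*} {P : ℕ}

lemma Drafter.take_mem (D : Drafter V P) (e : Env V) {w : List V} (hw : w ∈ D.tree e) (i : ℕ) :
    w.take i ∈ D.tree e := by
  induction w using List.reverseRecOn with
  | nil => simpa using hw
  | append_singleton w x ih =>
    rcases le_or_gt i w.length with h | h
    · rw [List.take_append_of_le_length h]
      exact ih (D.parent_mem e w x hw)
    · rwa [List.take_of_length_le (by simpa using h)]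

lemma IsInitial.take {y : ℕ → V} {w : List V} (h : IsInitial y w) (i : ℕ) :
    IsInitial y (w.take i) := by
  intro j
  have hj : (j : ℕ) < w.length := j.2.trans_le (by simp)
  have := h ⟨j, hj⟩
  simpa using this

open Classical in
/-- The nodes of the longest accepted path are accepted. -/
lemma acceptedLength_le_card (D : Drafter V P) (e : Env V) (y : ℕ → V) :
    acceptedLength (D.tree e) y ≤ ((D.tree e).filter fun w => IsInitial y w).card := by
  refine Finset.sup_le fun w hw => ?_
  rw [Finset.mem_filter] at hw
  rw [← Finset.card_range (w.length + 1)]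
  -- The `w.length + 1` prefixes of an accepted node, the root and the node itself included, are
  -- drafted and accepted; their lengths tell them apart.
  refine Finset.card_le_card_of_injOn (fun i => w.take i) (fun i _ => ?_) fun i hi j hj hij => ?_
  · simpa using ⟨D.take_mem e hw.1 i, hw.2.take i⟩
  · have := congrArg List.length hij
    simp only [Finset.coe_range, Set.mem_Iio] at hi hj
    simp only [List.length_take] at this
    omega

lemma acceptedLength_le_tsum (D : Drafter V P) (e : Env V) (y : ℕ → V) :
    (acceptedLength (D.tree e) y : ℝ≥0∞)
      ≤ ∑' w : List V, {w | w ∈ D.tree e ∧ IsInitial y w}.indicator 1 w := by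
  classical
  have h1 : (acceptedLength (D.tree e) y : ℝ≥0∞)
      ≤ (((D.tree e).filter fun w => IsInitial y w).card : ℝ≥0∞) := by
    exact_mod_cast acceptedLength_le_card D e y
  refine h1.trans (le_trans (le_of_eq ?_)
    (ENNReal.sum_le_tsum ((D.tree e).filter fun w => IsInitial y w)))
  rw [Finset.sum_congr rfl (g := fun _ => (1 : ℝ≥0∞))]
  · simp
  · intro w hw
    rw [Finset.mem_filter] at hw
    exact Set.indicator_of_mem (show w ∈ {w | w ∈ D.tree e ∧ IsInitial y w} from hw) _

lemma tsum_tree_le (D : Drafter V P) (e : Env V) :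
    ∑' w : List V, ({w | w ∈ D.tree e}.indicator 1 w : ℝ≥0∞) ≤ P := by
  rw [tsum_eq_sum (s := D.tree e) fun w hw =>
    Set.indicator_of_notMem (show w ∉ {w | w ∈ D.tree e} from hw) _,
    Finset.sum_congr rfl (g := fun _ => (1 : ℝ≥0∞)) fun w hw =>
      Set.indicator_of_mem (show w ∈ {w | w ∈ D.tree e} from hw) _]
  simpa using D.card_le e

lemma IsGenerated.measurableSet_isInitial {Ω : Type*} [MeasurableSpace Ω] {Pr : Measure Ω}
    {β : List V → Ω → V → ℝ} {Y : ℕ → Ω → V} (hY : IsGenerated β Y Pr) (w : List V) :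
    MeasurableSet {ω | IsInitial (fun n => Y n ω) w} := by
  have : {ω | IsInitial (fun n => Y n ω) w} = ⋂ i : Fin w.length, {ω | Y i ω = w.get i} := by
    ext ω; simp [IsInitial]
  rw [this]
  exact MeasurableSet.iInter fun i => hY.measurable i (w.get i)

end Accepted

variable {V Ω : Type*} [Fintype V] [MeasurableSpace Ω] {Pr : Measure Ω}
  {β : List V → Ω → V → ℝ} {Y : ℕ → Ω → V} {P : ℕ}

/-! ### The bound on the expected number of tokens -/

namespace IsIIDModel

lemma measurable_env (hβ : IsIIDModel β Pr) : Measurable (env β) :=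
  measurable_pi_iff.2 fun w => hβ.measurable w

lemma measurableSet_tree (hβ : IsIIDModel β Pr) (D : Drafter V P) (w : List V) :
    MeasurableSet {ω | w ∈ D.tree (env β ω)} :=
  hβ.measurable_env (D.measurable w)

lemma lintegral_numTokens_le (hβ : IsIIDModel β Pr) (hY : IsGenerated β Y Pr)
    (D : Drafter V P) :
    ∫⁻ ω, (numTokens β Y D ω : ℝ≥0∞) ∂Pr
      ≤ ∑' w : List V, Pr {ω | w ∈ D.tree (env β ω) ∧ IsInitial (fun n => Y n ω) w} := by
  refine (lintegral_mono fun ω => acceptedLength_le_tsum D (env β ω) fun n => Y n ω).trans ?_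
  have hm : ∀ w : List V,
      MeasurableSet {ω | w ∈ D.tree (env β ω) ∧ IsInitial (fun n => Y n ω) w} := fun w =>
    (hβ.measurableSet_tree D w).inter (hY.measurableSet_isInitial w)
  have hm' : ∀ w : List V, Measurable fun ω =>
      ({w | w ∈ D.tree (env β ω) ∧ IsInitial (fun n => Y n ω) w}.indicator 1 w : ℝ≥0∞) := fun w =>
    (measurable_one.indicator (hm w) :
      Measurable ({ω | w ∈ D.tree (env β ω) ∧ IsInitial (fun n => Y n ω) w}.indicator
        (1 : Ω → ℝ≥0∞)))
  rw [lintegral_tsum fun w => (hm' w).aemeasurable]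
  exact (tsum_congr fun w => (lintegral_indicator_one (hm w) :
    ∫⁻ ω, ({ω | w ∈ D.tree (env β ω) ∧ IsInitial (fun n => Y n ω) w}.indicator
      (1 : Ω → ℝ≥0∞)) ω ∂Pr = _)).le

variable [IsProbabilityMeasure Pr]

/-- Given the token tree, a drafted node is accepted with its path probability. -/
lemma measure_tree_inter_isInitial (hβ : IsIIDModel β Pr) (hY : IsGenerated β Y Pr)
    (D : Drafter V P) (w : List V) :
    Pr {ω | w ∈ D.tree (env β ω) ∧ IsInitial (fun n => Y n ω) w}
      = ∫⁻ ω in {ω | w ∈ D.tree (env β ω)}, ENNReal.ofReal (pathProb (env β ω) w) ∂Pr := by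
  set A := {ω | w ∈ D.tree (env β ω)} with hA
  set B := {ω | IsInitial (fun n => Y n ω) w} with hB
  have hBm : MeasurableSet B := hY.measurableSet_isInitial w
  have hAm := hβ.measurableSet_tree D w
  have hi : Integrable (B.indicator fun _ => (1 : ℝ)) Pr :=
    (integrable_const 1).indicator hBm
  -- The event that `w` is drafted depends on the token tree alone, so the conditional probability
  -- can be integrated over it.
  have h1 := setIntegral_condExp hβ.measurable_env.comap_le hi
    (show MeasurableSet[MeasurableSpace.comap (env β) inferInstance] A from
      ⟨_, D.measurable w, rfl⟩)
  rw [setIntegral_congr_ae (g := fun ω => pathProb (env β ω) w) hAm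
    ((hY.condProb w).mono fun ω h _ => h), integral_indicator hBm, Measure.restrict_restrict hBm]
    at h1
  have hpi : Integrable (fun ω => pathProb (env β ω) w) (Pr.restrict A) :=
    Integrable.of_bound (hβ.measurable_pathProb w).aestronglyMeasurable 1
      (Eventually.of_forall fun ω => by
        rw [Real.norm_of_nonneg (hβ.pathProb_nonneg w ω)]; exact hβ.pathProb_le_one w ω)
  rw [← ofReal_integral_eq_lintegral_ofReal hpi
    (Eventually.of_forall fun ω => hβ.pathProb_nonneg w ω), h1]
  simp only [integral_const, MeasurableSet.univ, measureReal_restrict_apply, Set.univ_inter,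
    smul_eq_mul, mul_one]
  rw [Set.inter_comm, ofReal_measureReal]
  rfl

lemma lintegral_renewalFn (hβ : IsIIDModel β Pr) (hna : ¬ IsArithmetic (logPoints β) Pr) {t : ℝ}
    (ht : 0 ≤ t) :
    ∫⁻ s in Set.Ioc 0 t, ENNReal.ofReal (Real.exp (-s)) * ∫⁻ ω, nodeCount (env β ω) s ∂Pr
      = ENNReal.ofReal (primitive (renewalFn β Pr) t) := by
  obtain ⟨C, hC⟩ := hβ.exists_abs_renewalFn_le hna
  rw [primitive, intervalIntegral.integral_of_le ht, ofReal_integral_eq_lintegral_ofReal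
    (intervalIntegrable_of_bound hβ.measurable_renewalFn hC 0 t).1
    (Eventually.of_forall renewalFn_nonneg)]
  refine lintegral_congr fun s => ?_
  rw [renewalFn, ENNReal.ofReal_mul (Real.exp_pos _).le,
    ENNReal.ofReal_toReal (hβ.lintegral_nodeCount_ne_top hna s)]

/-- By Tonelli's theorem the sum over words moves inside, where at each level `s` it counts the
nodes of position at most `s`. Summing over all words, not only drafted ones, removes the dependence
on the algorithm. -/
lemma tsum_lintegral_exceedance (hβ : IsIIDModel β Pr) (t : ℝ) :
    ∑' w : List V, ∫⁻ ω, (∫⁻ s in Set.Ioc 0 t, ENNReal.ofReal (Real.exp (-s))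
        * {s | Real.exp (-s) ≤ pathProb (env β ω) w}.indicator 1 s) ∂Pr
      = ∫⁻ s in Set.Ioc 0 t, ENNReal.ofReal (Real.exp (-s))
        * ∫⁻ ω, nodeCount (env β ω) s ∂Pr := by
  have hexp : Measurable fun s : ℝ => ENNReal.ofReal (Real.exp (-s)) :=
    (Real.measurable_exp.comp measurable_neg).ennreal_ofReal
  have h1 : ∀ w : List V, ∫⁻ ω, (∫⁻ s in Set.Ioc 0 t, ENNReal.ofReal (Real.exp (-s))
        * {s | Real.exp (-s) ≤ pathProb (env β ω) w}.indicator 1 s) ∂Pr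
      = ∫⁻ s in Set.Ioc 0 t, ENNReal.ofReal (Real.exp (-s)) * reachProb β Pr w s := by
    intro w
    have hS : MeasurableSet {q : Ω × ℝ | Real.exp (-q.2) ≤ pathProb (env β q.1) w} :=
      measurableSet_le (Real.measurable_exp.comp measurable_snd.neg)
        ((hβ.measurable_pathProb w).comp measurable_fst)
    have hm : Measurable (Function.uncurry fun (ω : Ω) (s : ℝ) => ENNReal.ofReal (Real.exp (-s))
        * ({s | Real.exp (-s) ≤ pathProb (env β ω) w}.indicator 1 s : ℝ≥0∞)) :=
      (hexp.comp measurable_snd).mul (measurable_one.indicator hS :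
        Measurable ({q : Ω × ℝ | Real.exp (-q.2) ≤ pathProb (env β q.1) w}.indicator
          (1 : Ω × ℝ → ℝ≥0∞)))
    rw [lintegral_lintegral_swap hm.aemeasurable]
    refine lintegral_congr fun s => ?_
    rw [lintegral_const_mul' _ _ ENNReal.ofReal_ne_top]
    congr 1
    exact (lintegral_indicator_one (hβ.measurableSet_reach w s) :
      ∫⁻ ω, ({ω | Real.exp (-s) ≤ pathProb (env β ω) w}.indicator (1 : Ω → ℝ≥0∞)) ω ∂Pr = _)
  simp_rw [h1]
  have hm : ∀ w : List V,
      Measurable fun s => ENNReal.ofReal (Real.exp (-s)) * reachProb β Pr w s := fun w =>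
    hexp.mul (reachProb_mono w).measurable
  rw [← lintegral_tsum fun w => (hm w).aemeasurable]
  refine lintegral_congr fun s => ?_
  rw [ENNReal.tsum_mul_left, hβ.lintegral_nodeCount_eq_tsum]

/-- The expected number of tokens is at most the expected total probability of the nodes of
position at most `log P`, up to an additive constant. -/
lemma integral_numTokens_le (hβ : IsIIDModel β Pr) (hna : ¬ IsArithmetic (logPoints β) Pr)
    (hY : IsGenerated β Y Pr) (D : Drafter V P) (hP : 0 < P) :
    ∫ ω, (numTokens β Y D ω : ℝ) ∂Pr ≤ 1 + primitive (renewalFn β Pr) (Real.log P) := by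
  set t := Real.log P with ht
  have hP' : (0 : ℝ) < P := by exact_mod_cast hP
  have ht0 : 0 ≤ t := Real.log_natCast_nonneg P
  have hprim : 0 ≤ primitive (renewalFn β Pr) t :=
    intervalIntegral.integral_nonneg ht0 fun s _ => renewalFn_nonneg s
  have hA := hβ.measurableSet_tree D
  have h1 : ∀ w : List V, Pr {ω | w ∈ D.tree (env β ω) ∧ IsInitial (fun n => Y n ω) w}
      ≤ ENNReal.ofReal (Real.exp (-t)) * Pr {ω | w ∈ D.tree (env β ω)}
        + ∫⁻ ω, (∫⁻ s in Set.Ioc 0 t, ENNReal.ofReal (Real.exp (-s))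
          * {s | Real.exp (-s) ≤ pathProb (env β ω) w}.indicator 1 s) ∂Pr := by
    intro w
    rw [hβ.measure_tree_inter_isInitial hY D w]
    refine (lintegral_mono fun ω => ofReal_le_add_lintegral (hβ.pathProb_le_one w ω) t).trans ?_
    rw [lintegral_add_left measurable_const, setLIntegral_const]
    exact add_le_add_right (setLIntegral_le_lintegral _ _) _
  have h2 : ∑' w : List V, Pr {ω | w ∈ D.tree (env β ω)} ≤ P := by
    have hm : ∀ w : List V, Measurable fun ω =>
        ({w | w ∈ D.tree (env β ω)}.indicator 1 w : ℝ≥0∞) := fun w =>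
      (measurable_one.indicator (hA w) :
        Measurable ({ω | w ∈ D.tree (env β ω)}.indicator (1 : Ω → ℝ≥0∞)))
    have e : ∀ w : List V, Pr {ω | w ∈ D.tree (env β ω)}
        = ∫⁻ ω, ({w | w ∈ D.tree (env β ω)}.indicator 1 w : ℝ≥0∞) ∂Pr := fun w =>
      (lintegral_indicator_one (hA w) :
        ∫⁻ ω, ({ω | w ∈ D.tree (env β ω)}.indicator (1 : Ω → ℝ≥0∞)) ω ∂Pr = _).symm
    simp_rw [e]
    rw [← lintegral_tsum fun w => (hm w).aemeasurable]
    exact (lintegral_mono fun ω => tsum_tree_le D (env β ω)).trans (by simp)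
  have h3 : ∫⁻ ω, (numTokens β Y D ω : ℝ≥0∞) ∂Pr
      ≤ ENNReal.ofReal (1 + primitive (renewalFn β Pr) t) := by
    refine (hβ.lintegral_numTokens_le hY D).trans ((ENNReal.tsum_le_tsum h1).trans ?_)
    rw [ENNReal.tsum_add, hβ.tsum_lintegral_exceedance, hβ.lintegral_renewalFn hna ht0,
      ENNReal.tsum_mul_left, ENNReal.ofReal_add zero_le_one hprim]
    -- At `t = log P` the improbable nodes contribute at most `exp (-t) * P = 1`.
    refine add_le_add_left ((mul_le_mul_right h2 _).trans (le_of_eq ?_)) _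
    rw [← ENNReal.ofReal_natCast, ← ENNReal.ofReal_mul (Real.exp_pos _).le, Real.exp_neg, ht,
      Real.exp_log hP', inv_mul_cancel₀ hP'.ne']
  -- This comparison with the lower integral requires no measurability of `X`.
  have h4 := norm_integral_le_lintegral_norm (μ := Pr) fun ω => (numTokens β Y D ω : ℝ)
  refine (le_abs_self _).trans (h4.trans ?_)
  refine ENNReal.toReal_le_of_le_ofReal (by linarith) (le_trans (le_of_eq ?_) h3)
  exact lintegral_congr fun ω => by simp

end IsIIDModel

end SpecDec

end

theorem mainTheorem2 {V Ω : Type*} [Fintype V] [MeasurableSpace Ω]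
    (Pr : Measure Ω) [IsProbabilityMeasure Pr]
    (β : List V → Ω → V → ℝ) (hβ : SpecDec.IsIIDModel β Pr)
    (hna : ¬ SpecDec.IsArithmetic (SpecDec.logPoints β) Pr)
    (Y : ℕ → Ω → V) (hY : SpecDec.IsGenerated β Y Pr) :
    (∃ r : ℕ → ℝ, r =o[atTop] (fun P : ℕ => Real.log P) ∧
      ∀ P : ℕ, 1 + SpecDec.meanSqLog β Pr / SpecDec.meanEntropy β Pr ^ 2 ≤ (P : ℝ) →
        ∀ D : SpecDec.Drafter V P,
          ∫ ω, (SpecDec.numTokens β Y D ω : ℝ) ∂Pr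
            ≤ Real.log P / SpecDec.meanEntropy β Pr + r P) ∧
    (∀ t : ℝ, ∫⁻ ω, SpecDec.nodeCount (SpecDec.env β ω) t ∂Pr ≠ ∞) ∧
    (fun t : ℝ => (∫⁻ ω, SpecDec.nodeCount (SpecDec.env β ω) t ∂Pr).toReal
        - Real.exp t / SpecDec.meanEntropy β Pr) =o[atTop] Real.exp := by
  -- The error is the constant `1` plus the Cesàro error of `Z` at `log P`; no drafter enters it.
  refine ⟨⟨fun P => 1 + (SpecDec.primitive (SpecDec.renewalFn β Pr) (Real.log P)
    - Real.log P * (SpecDec.meanEntropy β Pr)⁻¹), ?_, fun P _ D => ?_⟩,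
    hβ.lintegral_nodeCount_ne_top hna, hβ.lintegral_nodeCount_sub_isLittleO hna⟩
  · obtain ⟨C, hC⟩ := hβ.exists_abs_renewalFn_le hna
    have hlog : Tendsto (fun P : ℕ => Real.log P) atTop atTop :=
      Real.tendsto_log_atTop.comp tendsto_natCast_atTop_atTop
    refine IsLittleO.add ?_ ((SpecDec.primitive_sub_isLittleO hβ.measurable_renewalFn hC
      (hβ.tendsto_renewalFn hna)).comp_tendsto hlog)
    exact isLittleO_const_left.2 (Or.inr (tendsto_norm_atTop_atTop.comp hlog))
  · -- The draft tree contains the root, so its capacity is positive.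
    have hP : 0 < P :=
      (Finset.card_pos.2 ⟨[], D.root_mem fun _ _ => 0⟩).trans_le (D.card_le fun _ _ => 0)
    refine (hβ.integral_numTokens_le hna hY D hP).trans (le_of_eq ?_)
    rw [div_eq_mul_inv]
    ring
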